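/- Let $E$ be a countable set and let $R:E\times E\to\mathbb R$ satisfy $R(\eta,\xi)\ge 0$ for $\eta\ne\xi$, $R(\eta,\eta)<0$ and $\sum_{\xi\in E}R(\eta,\xi)=0$ for all $\eta\in E$. Put $\lambda(\eta)=-R(\eta,\eta)$, $p(\eta,\xi)=R(\eta,\xi)/\lambda(\eta)$ for $\xi\neq\eta$ and $p(\eta,\eta)=0$, and assume that the discrete-time Markov chain with transition probabilities $p$ is irreducible and recurrent. Under $\mathbf P_\eta$, let $Y=(Y_n)_{n\ge0}$ be this chain started from $\eta$, let $(e_n)_{n\ge 0}$ be i.i.d. mean-one exponential random variables independent of $Y$, and let $$T_n=\frac{e_n}{\lambda(Y_n)},\qquad \alpha(t)=\min\Big\{n\ge0:\sum_{i=0}^nT_i>t\Big\},\qquad \eta_t=Y_{\alpha(t)},\quad t\ge0,$$ so that $\{\eta_t:t\ge0\}$ is the continuous-time Markov chain with transition rates $R$. Let $h:E\to[0,\infty)$ with $F:=\{\eta\in E:h(\eta)>0\}\neq\varnothing$. The $h$-trace of $\{\eta_t\}$ is the $F$-valued process $$\eta^h_t=\eta_{\mathcal S^h_t},\qquad \mathcal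 S^h_t=\sup\{s\ge0:\mathcal T^h_s\le t\},\qquad \mathcal T^h_s=\int_0^s h(\eta_u)\,du .$$ For a process $X$ with state space $S$ (either $\eta_\cdot$ with $S=E$, or $\eta^h_\cdot$ with $S=F$), a nonzero function $\nu:S\to[0,\infty)$ is called an invariant measure if $\sum_{\eta\in S}\nu(\eta)\mathbf P_\eta[X_t=\xi]=\nu(\xi)$ for all $t\ge0$, $\xi\in S$, and a reversible measure if $\nu(\eta)\mathbf P_\eta[X_t=\xi]=\nu(\xi)\mathbf P_\xi[X_t=\eta]$ for all $t\ge0$, $\eta,\xi\in S$. The process $X$ is positive recurrent if every $\eta\in S$ is recurrent ($\{t\ge 0:X_t=\eta\}$ is unbounded $\mathbf P_\eta$-a.s.) and is either absorbing ($\mathbf P_\eta$-a.s. $X_t=\eta$ for all $t\ge 0$) or has finite mean return time, i.e. $\mathbf E_\eta[\tau^+_\eta]<\infty$ with $\tau^+_\eta=\inf\{t>0:X_t=\eta,\ X_s\ne X_0\text{ for some }0<s<t\}$. Let $\mu$ be an invariant measure for $\{\eta_t:t\ge0\}$ and let $\mu^h_o(\xi)=h(\xi)\mu(\xi)$ for $\xi\in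 F$. Then: 1. $\mu^h_o$ is an invariant measure for $\{\eta^h_t:t\ge0\}$. 2. If $h$ is $\mu$-integrable, i.e. $\sum_{\eta\in E}h(\eta)\mu(\eta)<\infty$, then $\{\eta^h_t:t\ge0\}$ is positive recurrent. 3. If $\mu$ is a reversible measure for $\{\eta_t:t\ge0\}$, then $\mu^h_o$ is a reversible measure for $\{\eta^h_t:t\ge0\}$. -/

import Mathlib

open MeasureTheory ProbabilityTheory Set Filter
open scoped NNReal ENNReal

noncomputable section

/-- Transition rates on `E`: nonnegative off-diagonal entries, strictly negative (finite) diagonal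
entries, rows summing to zero. -/
structure RateMatrix (E : Type*) where
  rate : E → E → ℝ
  rate_nonneg : ∀ η ξ, η ≠ ξ → 0 ≤ rate η ξ
  rate_diag_neg : ∀ η, rate η η < 0
  hasSum_rate : ∀ η, HasSum (rate η) 0

namespace RateMatrix

variable {E : Type*} (R : RateMatrix E)

/-- The holding rate `λ(η) = -R(η, η)`. -/
def holdingRate (η : E) : ℝ := -R.rate η η

lemma holdingRate_pos (η : E) : 0 < R.holdingRate η := by
  have := R.rate_diag_neg η
  unfold holdingRate
  linarith

open Classical in
/-- The jump probability `p(η, ξ)`: `R(η, ξ) / λ(η)` for `η ≠ ξ`, and `p(η, η) = 0`. -/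
def jumpProb (η ξ : E) : ℝ := if ξ = η then 0 else R.rate η ξ / R.holdingRate η

lemma jumpProb_nonneg (η ξ : E) : 0 ≤ R.jumpProb η ξ := by
  unfold jumpProb
  split_ifs with h
  · exact le_rfl
  · exact div_nonneg (R.rate_nonneg η ξ (Ne.symm h)) (R.holdingRate_pos η).le

lemma hasSum_jumpProb (η : E) : HasSum (R.jumpProb η) 1 := by
  classical
  have h1 := ((R.hasSum_rate η).update η 0).div_const (R.holdingRate η)
  have h2 : R.jumpProb η = fun ξ => Function.update (R.rate η) η 0 ξ / R.holdingRate η := by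
    funext ξ
    unfold jumpProb
    by_cases h : ξ = η
    · subst h; simp
    · simp [h]
  have h3 : (0 - R.rate η η + 0) / R.holdingRate η = 1 := by
    rw [zero_sub, add_zero]
    exact div_self (R.holdingRate_pos η).ne'
  rw [h2, ← h3]
  simpa using h1

/-- The law `p(η, ·)` of one step of the jump chain. -/
def jumpPMF (η : E) : PMF E :=
  ⟨fun ξ => ENNReal.ofReal (R.jumpProb η ξ), by
    have h := R.hasSum_jumpProb η
    rw [← ENNReal.ofReal_one, ← h.tsum_eq,
      ENNReal.ofReal_tsum_of_nonneg (R.jumpProb_nonneg η) h.summable]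
    exact ENNReal.summable.hasSum⟩

variable [Countable E] [MeasurableSpace E] [DiscreteMeasurableSpace E]

/-- The transition kernel of the jump chain. -/
def jumpKernel : Kernel E E := Kernel.ofFunOfCountable fun η => (R.jumpPMF η).toMeasure

instance : IsMarkovKernel R.jumpKernel :=
  ⟨fun η => by
    change IsProbabilityMeasure (R.jumpPMF η).toMeasure
    infer_instance⟩

/-- The same kernel, read as giving the law of the state at time `n + 1` from the states up to
time `n`; it looks at the state at time `n` only. -/
def stepKernel (n : ℕ) : Kernel ((i : Finset.Iic n) → (fun _ : ℕ => E) i) E :=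
  R.jumpKernel.comap (fun y => y ⟨n, Finset.mem_Iic.2 le_rfl⟩) (measurable_pi_apply _)

instance (n : ℕ) : IsMarkovKernel (R.stepKernel n) := by
  unfold stepKernel
  infer_instance

/-- The law on `ℕ → E` of the jump chain `Y` started from `η`: the Markov chain with transition
probabilities `p` (`fun _ => η` is its path up to time `0`). -/
def chainLaw (η : E) : Measure (ℕ → E) :=
  Kernel.traj (X := fun _ : ℕ => E) R.stepKernel 0 fun _ => η

/-- The jump chain is irreducible: from every state it reaches every state with positive
probability. -/
def ChainIrreducible : Prop :=
  ∀ η ξ : E, 0 < R.chainLaw η {y | ∃ n, y n = ξ}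

/-- The jump chain is recurrent: from every state it returns there infinitely often, almost
surely. -/
def ChainRecurrent : Prop :=
  ∀ η : E, ∀ᵐ y ∂(R.chainLaw η), ∃ᶠ n in atTop, y n = η

/-- `P_η`, the joint law of the jump chain `Y` started from `η` and of an independent sequence `e`
of i.i.d. mean-one exponential variables. -/
def law (η : E) : Measure ((ℕ → E) × (ℕ → ℝ)) :=
  (R.chainLaw η).prod (Measure.infinitePi fun _ : ℕ => expMeasure 1)

/-- The holding time `T_n = e_n / λ(Y_n)`. -/
def holdingTime (ω : (ℕ → E) × (ℕ → ℝ)) (n : ℕ) : ℝ := ω.2 n / R.holdingRate (ω.1 n)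

/-- `α(t) = min {n ≥ 0 : T_0 + ⋯ + T_n > t}`. -/
def jumpIndex (t : ℝ) (ω : (ℕ → E) × (ℕ → ℝ)) : ℕ :=
  sInf {n : ℕ | t < ∑ i ∈ Finset.range (n + 1), R.holdingTime ω i}

/-- The continuous-time Markov chain `η_t = Y_{α(t)}`, `t ≥ 0`. -/
def process (t : ℝ) (ω : (ℕ → E) × (ℕ → ℝ)) : E := ω.1 (R.jumpIndex t ω)

/-- The additive functional `∫_0^t h(η_s) ds`. -/
def additiveFunctional (h : E → ℝ≥0) (t : ℝ) (ω : (ℕ → E) × (ℕ → ℝ)) : ℝ≥0∞ :=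
  ∫⁻ s in Ioc 0 t, (h (R.process s ω) : ℝ≥0∞)

/-- The generalized inverse `sup {s ≥ 0 : ∫_0^s h(η_u) du ≤ t}` of the additive functional. -/
def inverseFunctional (h : E → ℝ≥0) (t : ℝ) (ω : (ℕ → E) × (ℕ → ℝ)) : ℝ :=
  sSup {s : ℝ | 0 ≤ s ∧ R.additiveFunctional h s ω ≤ ENNReal.ofReal t}

/-- The `h`-trace of the chain: the chain run along the generalized inverse. -/
def trace (h : E → ℝ≥0) (t : ℝ) (ω : (ℕ → E) × (ℕ → ℝ)) : E :=
  R.process (R.inverseFunctional h t ω) ω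

end RateMatrix

section Processes

variable {E Ω : Type*} [MeasurableSpace Ω]

/-! Below, `X t`, `t ≥ 0`, is a process whose law when started from `η ∈ S` is given by `P η`, and
`S` is its state space. A measure on `S` is given by its point masses, which are finite. -/

/-- `ν` is a (nonzero) invariant measure of the process:
`∑_η ν(η) P_η[X_t = ξ] = ν(ξ)` for all `t ≥ 0` and `ξ ∈ S`. -/
def IsInvariantMeasure (P : E → Measure Ω) (X : ℝ → Ω → E) (S : Set E) (ν : S → ℝ≥0) : Prop :=
  ν ≠ 0 ∧ ∀ t : ℝ, 0 ≤ t → ∀ ξ : S,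
    ∑' η : S, (ν η : ℝ≥0∞) * P η {ω | X t ω = ξ} = ν ξ

/-- `ν` is a (nonzero) reversible measure of the process:
`ν(η) P_η[X_t = ξ] = ν(ξ) P_ξ[X_t = η]` for all `t ≥ 0` and `η, ξ ∈ S`. -/
def IsReversibleMeasure (P : E → Measure Ω) (X : ℝ → Ω → E) (S : Set E) (ν : S → ℝ≥0) : Prop :=
  ν ≠ 0 ∧ ∀ t : ℝ, 0 ≤ t → ∀ η ξ : S,
    (ν η : ℝ≥0∞) * P η {ω | X t ω = ξ} = ν ξ * P ξ {ω | X t ω = η}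

/-- The first return time `inf {t > 0 : X_t = η, X_s ≠ X_0 for some 0 < s < t}` of the process to
`η`, which is infinite if there is no such `t`. -/
def returnTime (X : ℝ → Ω → E) (η : E) (ω : Ω) : ℝ≥0∞ :=
  ⨅ (t : ℝ) (_ : 0 < t ∧ X t ω = η ∧ ∃ s, 0 < s ∧ s < t ∧ X s ω ≠ X 0 ω), ENNReal.ofReal t

/-- The process is positive recurrent: every state is recurrent (the set of times spent there is
almost surely unbounded) and is either absorbing or has finite mean return time. -/
def IsPositiveRecurrent (P : E → Measure Ω) (X : ℝ → Ω → E) (S : Set E) : Prop :=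
  ∀ η ∈ S, (∀ᵐ ω ∂(P η), ¬ BddAbove {t : ℝ | 0 ≤ t ∧ X t ω = η}) ∧
    ((∀ᵐ ω ∂(P η), ∀ t : ℝ, 0 ≤ t → X t ω = η) ∨ ∫⁻ ω, returnTime X η ω ∂(P η) < ∞)

end Processes

end

/-! The trace is the same jump chain `Y` run with other holding times: state `ξ` is held for `h ξ /
λ(ξ)` times an exponential variable, possibly zero, instead of `1 / λ(ξ)` times one (`trace_eq`).
Both processes are therefore cases of one construction, a chain with mean holding times `w`, whose
time-`t` law is `transition w`.

The Laplace transform in `t` of this law is explicit. Since `e^{-b w x}` has mean `1 / (1 + b w)`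
under the exponential law, the transform at `b` is `G(η, ξ) * w ξ`, where `G` is the Green function
of `Y` with each visit to `ζ` weighted by `1 / (1 + b w ζ)` (`lintegral_exp_neg_transition`).
Invariance and reversibility thus become identities about Green functions, and these pass to and
from the one-step kernel `p` by algebra. With `σ = λ μ`, invariance of `μ` for the original process
gives `σ p = σ` (`invariant_of_tsum_green`). Conversely, by recurrence, `σ p = σ` gives the Green
identity at every `b` for the holding times of the trace (`tsum_green_of_invariant`), and inverting
Laplace transforms yields invariance of `σ w = h μ`. Reversibility travels the same way through
`symm_of_green_symm` and `green_symm`. Transforms determine functions only for almost every `t`;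
regularity in `t` gives the rest.

For positive recurrence, fix another state `ξ` of `F`. The return time of the trace to `η` is at
most the time it takes to visit `ξ` and then `η`, whose mean is at most a sum of two taboo
potentials. By the cycle bound `mul_tabooPotential_self_le`, `σ(b)` times the potential of `b` at
itself is at most `∑ σ w = ∑ h μ`, and irreducibility carries finiteness to all states. If `F` is a
single point, the trace is absorbed there. -/

noncomputable section

/-! ### Green functions of killed chains and their resolvent equations -/

section KilledPower

variable {E : Type*}

open Classical in
/-- The `n`-step weights of the kernel `p` when every visited state `ξ`, including the initial and
the final one, contributes a factor `z ξ`. -/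
def killedPower (p : E → E → ℝ≥0∞) (z : E → ℝ≥0∞) : ℕ → E → E → ℝ≥0∞
  | 0 => fun η ξ => if η = ξ then z ξ else 0
  | n + 1 => fun η ξ => (∑' ζ, killedPower p z n η ζ * p ζ ξ) * z ξ

/-- The Green function `∑ₙ killedPower p z n`. -/
def green (p : E → E → ℝ≥0∞) (z : E → ℝ≥0∞) (η ξ : E) : ℝ≥0∞ := ∑' n, killedPower p z n η ξ

variable (p : E → E → ℝ≥0∞) (z : E → ℝ≥0∞)

open Classical in
lemma killedPower_zero (η ξ : E) : killedPower p z 0 η ξ = if η = ξ then z ξ else 0 := rfl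

lemma killedPower_succ (n : ℕ) (η ξ : E) :
    killedPower p z (n + 1) η ξ = (∑' ζ, killedPower p z n η ζ * p ζ ξ) * z ξ := rfl

open Classical in
lemma tsum_ite_mul (η : E) (f : E → ℝ≥0∞) : ∑' ζ, (if η = ζ then 1 else 0) * f ζ = f η := by
  rw [tsum_eq_single η]
  · simp
  · intro b hb
    simp [hb.symm]

open Classical in
lemma tsum_mul_ite (ξ : E) (f : E → ℝ≥0∞) : ∑' ζ, f ζ * (if ζ = ξ then 1 else 0) = f ξ := by
  rw [tsum_eq_single ξ]
  · simp
  · intro b hb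
    simp [hb]

/-- Decomposition at the first step instead of the last; comparing the two gives the left resolvent
equation and path reversal. -/
lemma killedPower_succ' (n : ℕ) (η ξ : E) :
    killedPower p z (n + 1) η ξ = z η * ∑' ζ, p η ζ * killedPower p z n ζ ξ := by
  classical
  induction n generalizing ξ with
  | zero =>
    rw [killedPower_succ]
    simp only [killedPower_zero]
    have h1 : ∀ ζ, (if η = ζ then z ζ else 0) * p ζ ξ
        = (if η = ζ then 1 else 0) * (z ζ * p ζ ξ) := by
      intro ζ; split_ifs <;> simp
    have h2 : ∀ ζ, p η ζ * (if ζ = ξ then z ξ else 0)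
        = (p η ζ * z ζ) * (if ζ = ξ then 1 else 0) := by
      intro ζ; split_ifs with h <;> simp [h]
    simp only [h1, h2, tsum_ite_mul, tsum_mul_ite]
    ring
  | succ n ih =>
    rw [killedPower_succ]
    simp only [ih, killedPower_succ p z n]
    simp only [← ENNReal.tsum_mul_left, ← ENNReal.tsum_mul_right]
    rw [ENNReal.tsum_comm]
    refine tsum_congr fun ζ => tsum_congr fun θ => ?_
    ring

open Classical in
lemma green_eq_right (η ξ : E) :
    green p z η ξ = ((if η = ξ then 1 else 0) + ∑' ζ, green p z η ζ * p ζ ξ) * z ξ := by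
  unfold green
  rw [tsum_eq_zero_add' ENNReal.summable]
  simp only [killedPower_succ, killedPower_zero, ENNReal.tsum_mul_right, add_mul]
  congr 1
  · split_ifs <;> simp
  · simp only [← ENNReal.tsum_mul_right]
    rw [ENNReal.tsum_comm]

open Classical in
lemma green_eq_left (η ξ : E) :
    green p z η ξ = z η * ((if η = ξ then 1 else 0) + ∑' ζ, p η ζ * green p z ζ ξ) := by
  unfold green
  rw [tsum_eq_zero_add' ENNReal.summable]
  simp only [killedPower_succ', killedPower_zero, ENNReal.tsum_mul_left, mul_add]
  congr 1
  · split_ifs with h <;> simp [h]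
  · simp only [← ENNReal.tsum_mul_left]
    rw [ENNReal.tsum_comm]

lemma tsum_mul_green_eq (c : E → ℝ≥0∞) (ξ : E) :
    ∑' η, c η * green p z η ξ
      = (c ξ + ∑' ζ, (∑' η, c η * green p z η ζ) * p ζ ξ) * z ξ := by
  classical
  calc ∑' η, c η * green p z η ξ
      = ∑' η, (c η * (if η = ξ then 1 else 0) + ∑' ζ, c η * green p z η ζ * p ζ ξ) * z ξ := by
        refine tsum_congr fun η => ?_
        rw [green_eq_right, ← mul_assoc, mul_add, ← ENNReal.tsum_mul_left]
        simp only [mul_assoc]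
    _ = _ := by
        rw [ENNReal.tsum_mul_right, ENNReal.tsum_add, tsum_mul_ite, ENNReal.tsum_comm]
        simp only [ENNReal.tsum_mul_right]

/-- The potential of a charge `c` is the least supersolution of `f = (c + f p) z`. -/
lemma tsum_mul_green_le (c f : E → ℝ≥0∞)
    (hf : ∀ ξ, (c ξ + ∑' ζ, f ζ * p ζ ξ) * z ξ ≤ f ξ) (ξ : E) :
    ∑' η, c η * green p z η ξ ≤ f ξ := by
  classical
  have key : ∀ N : ℕ, ∀ ξ, ∑ n ∈ Finset.range N, ∑' η, c η * killedPower p z n η ξ ≤ f ξ := by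
    intro N
    induction N with
    | zero => simp
    | succ N ih =>
      intro ξ
      refine le_trans (le_of_eq ?_) ((mul_le_mul_left (add_le_add_right
        (ENNReal.tsum_le_tsum fun ζ => mul_le_mul_left (ih ζ) (p ζ ξ)) (c ξ)) (z ξ)).trans (hf ξ))
      rw [Finset.sum_range_succ', add_comm, add_mul]
      congr 1
      · simp only [killedPower_zero]
        have : ∀ η, c η * (if η = ξ then z ξ else 0)
            = (c η * z ξ) * (if η = ξ then 1 else 0) := by
          intro η; split_ifs <;> simp
        simp only [this, tsum_mul_ite]
      · simp only [Finset.sum_mul]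
        rw [Summable.tsum_finsetSum (fun _ _ => ENNReal.summable), Finset.sum_mul]
        refine Finset.sum_congr rfl fun n _ => ?_
        simp only [killedPower_succ, ← ENNReal.tsum_mul_left, ← ENNReal.tsum_mul_right]
        rw [ENNReal.tsum_comm]
        refine tsum_congr fun ζ => tsum_congr fun θ => ?_
        ring
  have h1 : ∑' η, c η * green p z η ξ = ∑' n, ∑' η, c η * killedPower p z n η ξ := by
    unfold green
    simp only [← ENNReal.tsum_mul_left]
    rw [ENNReal.tsum_comm]
  rw [h1, ENNReal.tsum_eq_iSup_nat]
  exact iSup_le fun N => key N ξ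

/-- An excessive function of a recurrent kernel is invariant. -/
lemma invariant_of_excessive (hrec : ∀ x, green p 1 x x = ∞) (S : E → ℝ≥0∞)
    (hfin : ∀ ξ, S ξ ≠ ∞) (hS : ∀ ξ, ∑' ζ, S ζ * p ζ ξ ≤ S ξ) (ξ : E) :
    ∑' ζ, S ζ * p ζ ξ = S ξ := by
  -- The defect `d` is a charge whose potential is dominated by the finite `S`; where the Green
  -- function is infinite on the diagonal it must vanish.
  set d : E → ℝ≥0∞ := fun ξ => S ξ - ∑' ζ, S ζ * p ζ ξ with hd
  have h1 : ∑' η, d η * green p 1 η ξ ≤ S ξ :=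
    tsum_mul_green_le p 1 d S (fun ξ => by simp [hd, tsub_add_cancel_of_le (hS ξ)]) ξ
  have h2 : d ξ * green p 1 ξ ξ ≤ S ξ := (ENNReal.le_tsum ξ).trans h1
  rw [hrec] at h2
  have h3 : d ξ = 0 := by
    by_contra h
    rw [ENNReal.mul_top h, top_le_iff] at h2
    exact hfin ξ h2
  exact le_antisymm (hS ξ) (tsub_eq_zero_iff_le.1 h3)

variable (W : E → ℝ≥0)

lemma inv_one_add_mul_cancel (a : ℝ≥0) (x : ℝ≥0∞) :
    x * (1 + (a : ℝ≥0∞))⁻¹ * (1 + a) = x := by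
  rw [mul_assoc, ENNReal.inv_mul_cancel (by simp) (by simp), mul_one]

/-- For `z = 1 / (1 + W)` the resolvent equation of the charge `σ W` reads `σ (1 + W) = σ W + σ p`,
and `σ W` cancels. Recurrence plays no role in this direction. -/
lemma invariant_of_tsum_green (σ : E → ℝ≥0)
    (h : ∀ ξ, ∑' η, (σ η : ℝ≥0∞) * W η * green p (fun η => (1 + (W η : ℝ≥0∞))⁻¹) η ξ = σ ξ)
    (ξ : E) : ∑' ζ, (σ ζ : ℝ≥0∞) * p ζ ξ = σ ξ := by
  have h1 := tsum_mul_green_eq p (fun η => (1 + (W η : ℝ≥0∞))⁻¹) (fun η => (σ η : ℝ≥0∞) * W η) ξ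
  simp only [h] at h1
  have h2 := congrArg (fun x => x * (1 + (W ξ : ℝ≥0∞))) h1
  simp only [inv_one_add_mul_cancel] at h2
  rw [mul_add, mul_one, add_comm] at h2
  exact ((ENNReal.add_right_inj (by finiteness)).1 h2).symm

/-- Let `S` be the potential of `σ W`. Minimality gives `S ≤ σ`, so the equation `S + S W = σ W + S
p` makes `S` excessive. Recurrence upgrades this to `S p = S`, leaving `S W = σ W`; this is why `W ξ
≠ 0` is needed. -/
lemma tsum_green_of_invariant (hrec : ∀ x, green p 1 x x = ∞) (σ : E → ℝ≥0)
    (h : ∀ ξ, ∑' ζ, (σ ζ : ℝ≥0∞) * p ζ ξ = σ ξ) (ξ : E) (hξ : W ξ ≠ 0) :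
    ∑' η, (σ η : ℝ≥0∞) * W η * green p (fun η => (1 + (W η : ℝ≥0∞))⁻¹) η ξ = σ ξ := by
  set S : E → ℝ≥0∞ := fun ξ =>
    ∑' η, (σ η : ℝ≥0∞) * W η * green p (fun η => (1 + (W η : ℝ≥0∞))⁻¹) η ξ with hS
  have hle : ∀ ξ, S ξ ≤ σ ξ := fun ξ => by
    refine tsum_mul_green_le p _ (fun η => (σ η : ℝ≥0∞) * W η) (fun η => σ η) (fun ξ => ?_) ξ
    rw [h]
    rw [show (σ ξ : ℝ≥0∞) * W ξ + σ ξ = σ ξ * (1 + W ξ) by ring, mul_assoc,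
      ENNReal.mul_inv_cancel (by simp) (by simp), mul_one]
  have hfin : ∀ ξ, S ξ ≠ ∞ := fun ξ => ne_top_of_le_ne_top ENNReal.coe_ne_top (hle ξ)
  have heq : ∀ ξ, S ξ + S ξ * W ξ = σ ξ * W ξ + ∑' ζ, S ζ * p ζ ξ := fun ξ => by
    have h1 := tsum_mul_green_eq p (fun η => (1 + (W η : ℝ≥0∞))⁻¹)
      (fun η => (σ η : ℝ≥0∞) * W η) ξ
    have h2 := congrArg (fun x => x * (1 + (W ξ : ℝ≥0∞))) h1
    simp only [inv_one_add_mul_cancel] at h2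
    rw [mul_add, mul_one] at h2
    exact h2
  have hexc : ∀ ξ, ∑' ζ, S ζ * p ζ ξ ≤ S ξ := fun ξ => by
    have h1 : S ξ * W ξ + ∑' ζ, S ζ * p ζ ξ ≤ S ξ * W ξ + S ξ := by
      rw [add_comm _ (S ξ), heq]
      gcongr
      exact hle ξ
    exact (ENNReal.add_le_add_iff_left (ENNReal.mul_ne_top (hfin ξ) ENNReal.coe_ne_top)).1 h1
  have h3 := heq ξ
  rw [invariant_of_excessive p hrec S hfin hexc ξ, add_comm] at h3
  have h4 := (ENNReal.add_left_inj (hfin ξ)).1 h3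
  exact (ENNReal.mul_left_inj (by exact_mod_cast hξ) ENNReal.coe_ne_top).1 h4

/-- Path reversal: both endpoints carry their factor `z`, so the weight of a path is unchanged when
it is reversed. -/
lemma killedPower_symm (σ : E → ℝ≥0∞) (h : ∀ η ξ, σ η * p η ξ = σ ξ * p ξ η) (n : ℕ) (η ξ : E) :
    σ η * killedPower p z n η ξ = σ ξ * killedPower p z n ξ η := by
  classical
  induction n generalizing η ξ with
  | zero =>
    simp only [killedPower_zero]
    by_cases hh : η = ξ
    · simp [hh]
    · simp [hh, Ne.symm hh]
  | succ n ih =>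
    rw [killedPower_succ, killedPower_succ']
    rw [← mul_assoc, ← ENNReal.tsum_mul_left, mul_left_comm, ← ENNReal.tsum_mul_left, mul_comm]
    congr 1
    refine tsum_congr fun ζ => ?_
    rw [← mul_assoc, ih, mul_right_comm, h, mul_assoc]

lemma green_symm (σ : E → ℝ≥0∞) (h : ∀ η ξ, σ η * p η ξ = σ ξ * p ξ η) (η ξ : E) :
    σ η * green p z η ξ = σ ξ * green p z ξ η := by
  unfold green
  simp only [← ENNReal.tsum_mul_left, killedPower_symm p z σ h _ η ξ]

/-- The Green function determines its kernel. The charges `σ(ζ) p(ζ, ξ)` and `σ(ξ) p(ξ, ζ)`, in the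
variable `ζ`, have the same potential by symmetry of `G`, and a charge is recovered from its
potential. The Green identity for `σ` supplies the finiteness needed to cancel. -/
lemma symm_of_green_symm (σ : E → ℝ≥0) (hσ : ∀ ξ, σ ξ ≠ 0) (hW : ∀ ξ, W ξ ≠ 0)
    (h : ∀ ξ, ∑' η, (σ η : ℝ≥0∞) * W η * green p (fun η => (1 + (W η : ℝ≥0∞))⁻¹) η ξ = σ ξ)
    (hsymm : ∀ η ξ, (σ η : ℝ≥0∞) * green p (fun η => (1 + (W η : ℝ≥0∞))⁻¹) η ξ
      = σ ξ * green p (fun η => (1 + (W η : ℝ≥0∞))⁻¹) ξ η) (η ξ : E) :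
    (σ η : ℝ≥0∞) * p η ξ = σ ξ * p ξ η := by
  classical
  set G := green p (fun η => (1 + (W η : ℝ≥0∞))⁻¹) with hG
  have hGfin : ∀ η ξ, G η ξ ≠ ∞ := by
    intro η ξ htop
    have h1 : (σ η : ℝ≥0∞) * W η * G η ξ ≤ σ ξ := (ENNReal.le_tsum η).trans (h ξ).le
    rw [htop, ENNReal.mul_top (by simp [hσ, hW]), top_le_iff] at h1
    exact ENNReal.coe_ne_top h1
  have hright : ∀ η ξ, G η ξ * (1 + W ξ) = (if η = ξ then 1 else 0) + ∑' ζ, G η ζ * p ζ ξ := by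
    intro η ξ
    rw [hG, green_eq_right, inv_one_add_mul_cancel]
  have hleft : ∀ η ξ, G η ξ * (1 + W η) = (if η = ξ then 1 else 0) + ∑' ζ, p η ζ * G ζ ξ := by
    intro η ξ
    rw [hG, green_eq_left, mul_comm (1 + (W η : ℝ≥0∞))⁻¹, inv_one_add_mul_cancel]
  have hA : ∀ θ, ∑' ζ, (σ ζ : ℝ≥0∞) * p ζ ξ * G ζ θ = σ θ * ∑' ζ, G θ ζ * p ζ ξ := by
    intro θ
    rw [← ENNReal.tsum_mul_left]
    refine tsum_congr fun ζ => ?_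
    rw [mul_right_comm, hsymm, mul_assoc]
  have hB : ∀ θ, ∑' ζ, (σ ξ : ℝ≥0∞) * p ξ ζ * G ζ θ = σ ξ * ∑' ζ, p ξ ζ * G ζ θ := by
    intro θ
    rw [← ENNReal.tsum_mul_left]
    exact tsum_congr fun ζ => mul_assoc _ _ _
  have hAfin : ∀ θ, ∑' ζ, (σ ζ : ℝ≥0∞) * p ζ ξ * G ζ θ ≠ ∞ := by
    intro θ
    rw [hA]
    refine ENNReal.mul_ne_top ENNReal.coe_ne_top (ne_top_of_le_ne_top ?_
      (le_add_self.trans (hright θ ξ).ge))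
    exact ENNReal.mul_ne_top (hGfin _ _) (by simp)
  -- Expand `σ(θ) G(θ, ξ) (1 + W ξ)` by the last step and its mirror `σ(ξ) G(ξ, θ) (1 + W ξ)` by the
  -- first; the diagonal terms agree and cancel.
  have hAB : ∀ θ, ∑' ζ, (σ ζ : ℝ≥0∞) * p ζ ξ * G ζ θ = ∑' ζ, (σ ξ : ℝ≥0∞) * p ξ ζ * G ζ θ := by
    intro θ
    rw [hA, hB]
    have h1 : (σ θ : ℝ≥0∞) * (G θ ξ * (1 + W ξ)) = σ ξ * (G ξ θ * (1 + W ξ)) := by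
      rw [← mul_assoc, hsymm, mul_assoc]
    rw [hright, hleft, mul_add, mul_add] at h1
    have h2 : (σ θ : ℝ≥0∞) * (if θ = ξ then 1 else 0) = σ ξ * (if ξ = θ then 1 else 0) := by
      by_cases hh : θ = ξ
      · simp [hh]
      · simp [hh, Ne.symm hh]
    rw [h2] at h1
    refine (ENNReal.add_right_inj ?_).1 h1
    split_ifs <;> simp
  have hexp : ∀ a : E → ℝ≥0∞, (∑' ζ, a ζ * G ζ η) * (1 + W η)
      = a η + ∑' θ, (∑' ζ, a ζ * G ζ θ) * p θ η := by
    intro a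
    rw [hG, tsum_mul_green_eq, inv_one_add_mul_cancel]
  have e1 := hexp fun ζ => (σ ζ : ℝ≥0∞) * p ζ ξ
  have e2 := hexp fun ζ => (σ ξ : ℝ≥0∞) * p ξ ζ
  simp only [← hAB] at e2
  rw [e1] at e2
  refine (ENNReal.add_left_inj (ne_top_of_le_ne_top ?_ (le_add_self.trans e1.ge))).1 e2
  exact ENNReal.mul_ne_top (hAfin η) (by simp)

end KilledPower

/-! ### Potentials up to the first return to a state -/

section Taboo

variable {E : Type*} (p : E → E → ℝ≥0∞)

open Classical in
/-- The kernel `p` with the entrances into `b` removed. -/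
def tabooKernel (b η ξ : E) : ℝ≥0∞ := if ξ = b then 0 else p η ξ

/-- The expected `w`-weight collected before the first return to `b`. -/
def tabooPotential (w : E → ℝ≥0∞) (b η : E) : ℝ≥0∞ :=
  ∑' ξ, green (tabooKernel p b) 1 η ξ * w ξ

variable (w : E → ℝ≥0∞) (b : E)

lemma tabooPotential_eq (η : E) :
    tabooPotential p w b η
      = w η + ∑' ξ, tabooKernel p b η ξ * tabooPotential p w b ξ := by
  classical
  unfold tabooPotential
  conv_lhs =>
    enter [1, ξ]
    rw [green_eq_left]
  simp only [Pi.one_apply, one_mul, add_mul]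
  rw [ENNReal.tsum_add, tsum_ite_mul]
  congr 1
  simp only [← ENNReal.tsum_mul_left, ← ENNReal.tsum_mul_right]
  rw [ENNReal.tsum_comm]
  simp only [mul_assoc]

/-- Cycle bound: `σ` solves the equation of the taboo kernel with charge `σ b` at `b`, so it
dominates the least solution, which is `σ b` times the expected numbers of visits during a cycle
from `b`. -/
lemma mul_tabooPotential_self_le (σ : E → ℝ≥0∞) (h : ∀ ξ, ∑' ζ, σ ζ * p ζ ξ = σ ξ) :
    σ b * tabooPotential p w b b ≤ ∑' ξ, σ ξ * w ξ := by
  classical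
  unfold tabooPotential
  rw [← ENNReal.tsum_mul_left]
  refine ENNReal.tsum_le_tsum fun ξ => ?_
  rw [← mul_assoc]
  gcongr
  refine le_trans ?_ (tsum_mul_green_le (tabooKernel p b) 1
    (fun η => if η = b then σ b else 0) σ (fun ξ => ?_) ξ)
  · exact le_of_eq_of_le (by simp) (ENNReal.le_tsum b)
  · by_cases hξ : ξ = b
    · subst hξ
      simp [tabooKernel]
    · simp [tabooKernel, hξ, h]

/-- Finiteness spreads along paths of positive weight: a step from `ζ` to `η ≠ b` survives the
taboo, so an infinite potential at `η` would force one at `ζ`. -/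
lemma tabooPotential_ne_top (hb : tabooPotential p w b b ≠ ∞) (n : ℕ) (η : E)
    (hη : killedPower p 1 n b η ≠ 0) : tabooPotential p w b η ≠ ∞ := by
  classical
  induction n generalizing η with
  | zero =>
    rw [killedPower_zero] at hη
    have : b = η := by by_contra hh; simp [hh] at hη
    rwa [← this]
  | succ n ih =>
    by_cases hηb : η = b
    · rwa [hηb]
    rw [killedPower_succ, Pi.one_apply, mul_one, ne_eq, ENNReal.tsum_eq_zero, not_forall] at hη
    obtain ⟨ζ, hζ⟩ := hη
    have h1 := ih ζ (left_ne_zero_of_mul hζ)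
    rw [tabooPotential_eq] at h1
    intro htop
    refine h1 (top_le_iff.1 (le_trans ?_ (le_add_self.trans' (ENNReal.le_tsum η))))
    rw [htop, ENNReal.mul_top]
    simpa [tabooKernel, hηb] using right_ne_zero_of_mul hζ

end Taboo

/-! ### Uniqueness of Laplace transforms sampled at integers -/

section Laplace

lemma hasSum_complexMGF_of_bounded {Ω : Type*} [MeasurableSpace Ω] (m : Measure Ω)
    [IsFiniteMeasure m] (X : Ω → ℝ) (hX : Measurable X) (hb : ∀ᵐ x ∂m, |X x| ≤ 1) (s : ℂ) :
    HasSum (fun k : ℕ => s ^ k / (k.factorial : ℂ) * ((∫ x, X x ^ k ∂m : ℝ) : ℂ))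
      (complexMGF X m s) := by
  have hbk : ∀ k : ℕ, ∀ᵐ x ∂m, ‖((X x : ℝ) : ℂ) ^ k‖ ≤ 1 := by
    intro k
    filter_upwards [hb] with x hx
    rw [norm_pow, Complex.norm_real, Real.norm_eq_abs]
    exact pow_le_one₀ (abs_nonneg _) hx
  have hint : ∀ k : ℕ, Integrable (fun x => ((X x : ℝ) : ℂ) ^ k) m := by
    intro k
    exact Integrable.of_bound (by fun_prop) 1 (hbk k)
  have h := hasSum_integral_of_summable_integral_norm (μ := m)
    (F := fun (k : ℕ) x => s ^ k / (k.factorial : ℂ) * ((X x : ℝ) : ℂ) ^ k)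
    (fun k => (hint k).const_mul _) (by
      refine Summable.of_nonneg_of_le (fun k => integral_nonneg fun x => norm_nonneg _)
        (fun k => ?_) ((Real.summable_pow_div_factorial ‖s‖).mul_right (m.real univ))
      have : ∀ x, ‖s ^ k / (k.factorial : ℂ) * ((X x : ℝ) : ℂ) ^ k‖
          = ‖s‖ ^ k / k.factorial * ‖((X x : ℝ) : ℂ) ^ k‖ := by
        intro x
        rw [norm_mul, norm_div, norm_pow]
        simp
      simp only [this]
      rw [integral_const_mul]
      refine mul_le_mul_of_nonneg_left ?_ (by positivity)
      calc ∫ x, ‖((X x : ℝ) : ℂ) ^ k‖ ∂m ≤ ∫ _, (1 : ℝ) ∂m :=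
            integral_mono_ae (hint k).norm (integrable_const _) (hbk k)
        _ = m.real univ := by simp)
  have e1 : (fun k : ℕ => s ^ k / (k.factorial : ℂ) * ((∫ x, X x ^ k ∂m : ℝ) : ℂ))
      = fun k : ℕ => ∫ x, s ^ k / (k.factorial : ℂ) * ((X x : ℝ) : ℂ) ^ k ∂m := by
    funext k
    rw [integral_const_mul]
    congr 1
    rw [← integral_complex_ofReal]
    simp
  have e2 : complexMGF X m s
      = ∫ x, ∑' k : ℕ, s ^ k / (k.factorial : ℂ) * ((X x : ℝ) : ℂ) ^ k ∂m := by
    unfold complexMGF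
    refine integral_congr_ae (Eventually.of_forall fun x => ?_)
    simp only
    rw [Complex.exp_eq_exp_ℂ, NormedSpace.exp_eq_tsum_div]
    refine tsum_congr fun k => ?_
    rw [mul_pow]
    ring
  rw [e1, e2]
  exact h

/-- Under `t ↦ e^{-t}` the data become the moments of measures on a bounded interval. These
determine the complex moment generating function, hence the image measure, and the map is injective.
-/
lemma Measure.ext_of_lintegral_exp_neg_nat {m₁ m₂ : Measure ℝ} [IsFiniteMeasure m₁]
    [IsFiniteMeasure m₂] (h₁ : ∀ᵐ t ∂m₁, 0 < t) (h₂ : ∀ᵐ t ∂m₂, 0 < t)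
    (h : ∀ k : ℕ, ∫⁻ t, ENNReal.ofReal (Real.exp (-(k * t))) ∂m₁
      = ∫⁻ t, ENNReal.ofReal (Real.exp (-(k * t))) ∂m₂) : m₁ = m₂ := by
  set X : ℝ → ℝ := fun t => Real.exp (-t) with hXdef
  have hXm : Measurable X := by fun_prop
  have hb : ∀ m : Measure ℝ, (∀ᵐ t ∂m, 0 < t) → ∀ᵐ t ∂m, |X t| ≤ 1 := by
    intro m hm
    filter_upwards [hm] with t ht
    rw [abs_of_pos (Real.exp_pos _), Real.exp_le_one_iff]
    linarith
  have hmom : ∀ m : Measure ℝ, ∀ k : ℕ, ∫ t, X t ^ k ∂m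
      = (∫⁻ t, ENNReal.ofReal (Real.exp (-(k * t))) ∂m).toReal := by
    intro m k
    rw [integral_eq_lintegral_of_nonneg_ae
      (Eventually.of_forall fun t => pow_nonneg (Real.exp_pos _).le _)
      (by fun_prop)]
    congr 1
    refine lintegral_congr fun t => ?_
    rw [← Real.exp_nat_mul]
    ring_nf
  have hmap : m₁.map X = m₂.map X := by
    refine Measure.ext_of_complexMGF_eq hXm.aemeasurable hXm.aemeasurable (funext fun s => ?_)
    refine (hasSum_complexMGF_of_bounded m₁ X hXm (hb m₁ h₁) s).unique ?_
    simp only [hmom m₁, h, ← hmom m₂]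
    exact hasSum_complexMGF_of_bounded m₂ X hXm (hb m₂ h₂) s
  have hemb : MeasurableEmbedding X :=
    Continuous.measurableEmbedding (by fun_prop)
      (fun a b hab => by simpa using Real.exp_injective hab)
  rw [← hemb.comap_map m₁, hmap, hemb.comap_map]

/-- Nonnegative functions on `(0, ∞)` are determined by their Laplace transforms at the positive
integers. -/
lemma ae_eq_of_lintegral_exp_neg_nat {f g : ℝ → ℝ≥0∞} (hf : Measurable f) (hg : Measurable g)
    (hfin : ∀ k : ℕ,
      ∫⁻ t in Ioi 0, ENNReal.ofReal (Real.exp (-((k + 1) * t))) * f t ≠ ∞)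
    (h : ∀ k : ℕ, ∫⁻ t in Ioi 0, ENNReal.ofReal (Real.exp (-((k + 1) * t))) * f t
      = ∫⁻ t in Ioi 0, ENNReal.ofReal (Real.exp (-((k + 1) * t))) * g t) :
    f =ᵐ[volume.restrict (Ioi 0)] g := by
  -- One factor `e^{-t}` goes into the density to make the measures finite; what remains of the
  -- transform at `k + 1` is the one at `k`.
  set F : ℝ → ℝ≥0∞ := fun t => ENNReal.ofReal (Real.exp (-t)) * f t with hF
  set G : ℝ → ℝ≥0∞ := fun t => ENNReal.ofReal (Real.exp (-t)) * g t with hG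
  have hFm : Measurable F := by fun_prop
  have hGm : Measurable G := by fun_prop
  have hFfin : ∫⁻ t in Ioi 0, F t ≠ ∞ := by simpa [hF] using hfin 0
  have hGfin : ∫⁻ t in Ioi 0, G t ≠ ∞ := by
    have := (h 0).symm ▸ hfin 0
    simpa [hG] using this
  have : IsFiniteMeasure ((volume.restrict (Ioi (0 : ℝ))).withDensity F) :=
    isFiniteMeasure_withDensity hFfin
  have : IsFiniteMeasure ((volume.restrict (Ioi (0 : ℝ))).withDensity G) :=
    isFiniteMeasure_withDensity hGfin
  have hpos : ∀ᵐ t ∂(volume.restrict (Ioi (0 : ℝ))), 0 < t := ae_restrict_mem measurableSet_Ioi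
  have hk : ∀ k : ℕ, ∀ f : ℝ → ℝ≥0∞, Measurable f →
      ∫⁻ t, ENNReal.ofReal (Real.exp (-(k * t))) ∂((volume.restrict (Ioi (0 : ℝ))).withDensity
        fun t => ENNReal.ofReal (Real.exp (-t)) * f t)
      = ∫⁻ t in Ioi 0, ENNReal.ofReal (Real.exp (-((k + 1) * t))) * f t := by
    intro k f hf
    rw [lintegral_withDensity_eq_lintegral_mul _ (by fun_prop) (by fun_prop)]
    refine lintegral_congr fun t => ?_
    simp only [Pi.mul_apply]
    rw [mul_right_comm, ← ENNReal.ofReal_mul (Real.exp_pos _).le, ← Real.exp_add]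
    ring_nf
  have hmeas : (volume.restrict (Ioi (0 : ℝ))).withDensity F
      = (volume.restrict (Ioi (0 : ℝ))).withDensity G := by
    refine Measure.ext_of_lintegral_exp_neg_nat
      ((withDensity_absolutelyContinuous _ _).ae_le hpos)
      ((withDensity_absolutelyContinuous _ _).ae_le hpos) fun k => ?_
    rw [hk k f hf, hk k g hg, h k]
  have := (withDensity_eq_iff hFm.aemeasurable hGm.aemeasurable hFfin).1 hmeas
  filter_upwards [this] with t ht
  refine (ENNReal.mul_right_inj ?_ ENNReal.ofReal_ne_top).1 ht
  simpa using Real.exp_pos _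

end Laplace

/-! ### The jump chain: Markov property and expected path weights -/

namespace RateMatrix

variable {E : Type*} (R : RateMatrix E)

/-- The jump probabilities as a matrix with entries in `ℝ≥0∞`. -/
def jumpMatrix (η ξ : E) : ℝ≥0∞ := R.jumpPMF η ξ

variable [Countable E] [MeasurableSpace E] [DiscreteMeasurableSpace E]

instance (η : E) : IsProbabilityMeasure (R.chainLaw η) := by
  unfold chainLaw
  infer_instance

lemma ae_chainLaw_zero (η : E) : ∀ᵐ y ∂(R.chainLaw η), y 0 = η := by
  have h : (R.chainLaw η).map (Preorder.frestrictLe 0)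
      = Measure.dirac (fun _ : Finset.Iic 0 => η) := by
    unfold chainLaw
    rw [Kernel.traj_map_frestrictLe_apply, Kernel.partialTraj_self, Kernel.id_apply]
  have h2 : ∀ᵐ x ∂((R.chainLaw η).map (Preorder.frestrictLe 0)),
      x ⟨0, Finset.mem_Iic.2 le_rfl⟩ = η := by
    rw [h]
    rw [ae_dirac_iff]
    · exact measurableSet_eq_fun (measurable_pi_apply _) measurable_const
  exact ae_of_ae_map (Measurable.aemeasurable (by fun_prop)) h2

/-- The Markov property of the jump chain at a fixed time. -/
lemma lintegral_chainLaw_succ (η : E) (n : ℕ) (Φ : ((i : Finset.Iic n) → E) → ℝ≥0∞)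
    (hΦ : Measurable Φ) (g : E → ℝ≥0∞) :
    ∫⁻ y, Φ (fun i => y i) * g (y (n + 1)) ∂(R.chainLaw η)
      = ∫⁻ y, Φ (fun i => y i) * ∑' ξ, R.jumpMatrix (y n) ξ * g ξ ∂(R.chainLaw η) := by
  have hg : Measurable g := .of_discrete
  have h := Kernel.partialTraj_compProd_eq_map_traj (X := fun _ : ℕ => E) (κ := R.stepKernel)
    (Nat.zero_le n) (x₀ := fun _ => η)
  have h2 := congrArg (fun m => ∫⁻ x, Φ x.1 * g x.2 ∂m) h
  rw [lintegral_map (by fun_prop) (by fun_prop), Measure.lintegral_compProd (by fun_prop),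
    ← Kernel.traj_map_frestrictLe_apply, lintegral_map (by fun_prop) (by fun_prop)] at h2
  refine h2.symm.trans (lintegral_congr fun y => ?_)
  change ∫⁻ b, Φ (fun i => y i) * g b ∂(R.stepKernel n (fun i => y i)) = _
  rw [lintegral_const_mul _ hg]
  congr 1
  change ∫⁻ ξ, g ξ ∂((R.jumpPMF (y n)).toMeasure) = _
  rw [lintegral_countable']
  refine tsum_congr fun ξ => ?_
  rw [PMF.toMeasure_apply_singleton _ _ (measurableSet_singleton ξ), mul_comm]
  rfl

open Classical in
lemma lintegral_chainLaw_succ_ite (η : E) (n : ℕ) (Φ : ((i : Finset.Iic n) → E) → ℝ≥0∞)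
    (hΦ : Measurable Φ) (ξ : E) :
    ∫⁻ y, Φ (fun i => y i) * (if y (n + 1) = ξ then 1 else 0) ∂(R.chainLaw η)
      = ∑' ζ, (∫⁻ y, Φ (fun i => y i) * (if y n = ζ then 1 else 0) ∂(R.chainLaw η))
        * R.jumpMatrix ζ ξ := by
  have hm : ∀ ζ : E, Measurable fun y : ℕ → E => if y n = ζ then (1 : ℝ≥0∞) else 0 := fun ζ =>
    Measurable.ite (measurableSet_eq_fun (measurable_pi_apply _) measurable_const)
      measurable_const measurable_const
  rw [R.lintegral_chainLaw_succ η n Φ hΦ fun x => if x = ξ then 1 else 0]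
  simp only [tsum_mul_ite]
  simp only [← lintegral_mul_const _ (show Measurable fun y : ℕ → E =>
    Φ (fun i => y i) * (if y n = _ then 1 else 0) from
      Measurable.mul (by fun_prop) (hm _))]
  rw [← lintegral_tsum fun ζ => (Measurable.mul_const (f := fun y : ℕ → E =>
    Φ (fun i => y i) * (if y n = ζ then 1 else 0)) (Measurable.mul (by fun_prop) (hm ζ))
    (R.jumpMatrix ζ ξ)).aemeasurable]
  refine lintegral_congr fun y => ?_
  rw [← tsum_ite_mul (y n) (fun ζ => Φ (fun i => y i) * R.jumpMatrix ζ ξ)]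
  refine tsum_congr fun ζ => ?_
  ring

open Classical in
lemma lintegral_chainLaw_prod (z : E → ℝ≥0∞) (n : ℕ) (η ξ : E) :
    ∫⁻ y, (∏ i ∈ Finset.range (n + 1), z (y i)) * (if y n = ξ then 1 else 0) ∂(R.chainLaw η)
      = killedPower R.jumpMatrix z n η ξ := by
  induction n generalizing ξ with
  | zero =>
    rw [killedPower_zero]
    have : ∀ᵐ y ∂(R.chainLaw η), (∏ i ∈ Finset.range (0 + 1), z (y i))
        * (if y 0 = ξ then 1 else 0) = if η = ξ then z ξ else 0 := by
      filter_upwards [R.ae_chainLaw_zero η] with y hy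
      simp only [zero_add, Finset.range_one, Finset.prod_singleton, hy]
      split_ifs with h <;> simp [h]
    rw [lintegral_congr_ae this]
    simp
  | succ n ih =>
    have hz : Measurable z := .of_discrete
    have h := R.lintegral_chainLaw_succ_ite η n
      (fun x => ∏ i : Finset.Iic n, z (x i)) (by fun_prop) ξ
    have hprod : ∀ y : ℕ → E, ∏ i : Finset.Iic n, z (y i)
        = ∏ i ∈ Finset.range (n + 1), z (y i) := by
      intro y
      rw [Finset.prod_coe_sort (Finset.Iic n) fun i => z (y i)]
      refine Finset.prod_congr ?_ fun _ _ => rfl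
      ext i
      simp
    simp only [hprod, ih] at h
    rw [killedPower_succ, ← h, ← lintegral_mul_const]
    · refine lintegral_congr fun y => ?_
      rw [Finset.prod_range_succ]
      split_ifs with hy <;> simp [hy]
    · refine Measurable.mul (by fun_prop) (Measurable.ite (measurableSet_eq_fun
        (measurable_pi_apply _) measurable_const) measurable_const measurable_const)

lemma measurableSet_chain_eq (n : ℕ) (ξ : E) : MeasurableSet {y : ℕ → E | y n = ξ} :=
  measurableSet_eq_fun (measurable_pi_apply _) measurable_const

lemma chainLaw_apply_eq (n : ℕ) (η ξ : E) :
    R.chainLaw η {y | y n = ξ} = killedPower R.jumpMatrix 1 n η ξ := by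
  classical
  rw [← R.lintegral_chainLaw_prod, ← lintegral_indicator_one (measurableSet_chain_eq n ξ)]
  refine lintegral_congr fun y => ?_
  simp [indicator_apply]

/-- Borel–Cantelli: a finite Green function would allow only finitely many visits to `η`. -/
lemma ChainRecurrent.green_eq_top (hrec : R.ChainRecurrent) (η : E) :
    green R.jumpMatrix 1 η η = ∞ := by
  by_contra hfin
  have h : ∑' n, R.chainLaw η {y | y n = η} ≠ ∞ := by
    simp only [R.chainLaw_apply_eq]
    exact hfin
  have h1 := ae_eventually_notMem h
  obtain ⟨y, hy1, hy2⟩ := ((hrec η).and h1).exists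
  exact hy1 hy2

lemma ChainIrreducible.exists_killedPower_ne_zero (hirr : R.ChainIrreducible) (η ξ : E) :
    ∃ n, killedPower R.jumpMatrix 1 n η ξ ≠ 0 := by
  by_contra! hcon
  refine (hirr η ξ).ne' ?_
  rw [ofPred_exists, measure_iUnion_null_iff]
  intro n
  rw [R.chainLaw_apply_eq, hcon]

end RateMatrix

/-! ### Exponential variables and i.i.d. sequences of them -/

section Exponential

instance isProbabilityMeasure_expMeasure_one : IsProbabilityMeasure (expMeasure 1) :=
  isProbabilityMeasure_expMeasure one_pos

lemma lintegral_expMeasure_one (f : ℝ → ℝ≥0∞) (hf : Measurable f) :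
    ∫⁻ x, f x ∂(expMeasure 1) = ∫⁻ x in Ioi 0, ENNReal.ofReal (Real.exp (-x)) * f x := by
  have h : expMeasure 1 = volume.withDensity (exponentialPDF 1) := rfl
  have hm : Measurable (exponentialPDF 1) := (measurable_exponentialPDFReal 1).ennreal_ofReal
  rw [h, lintegral_withDensity_eq_lintegral_mul _ hm hf,
    ← lintegral_add_compl _ measurableSet_Ici (A := Ici (0 : ℝ)), compl_Ici]
  have h0 : ∫⁻ x in Iio (0 : ℝ), (exponentialPDF 1 * f) x = 0 := by
    rw [setLIntegral_congr_fun measurableSet_Iio (g := fun _ => 0)]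
    · simp
    · intro x hx
      simp [exponentialPDF_of_neg (mem_Iio.1 hx)]
  rw [h0, add_zero, ← setLIntegral_congr Ioi_ae_eq_Ici]
  refine setLIntegral_congr_fun measurableSet_Ioi fun x hx => ?_
  simp [exponentialPDF_of_nonneg (mem_Ioi.1 hx).le]

lemma lintegral_exp_neg_mul_Ioi {c : ℝ} (hc : 0 < c) (a : ℝ) :
    ∫⁻ t in Ioi a, ENNReal.ofReal (Real.exp (-(c * t)))
      = ENNReal.ofReal (Real.exp (-(c * a)) / c) := by
  have hint := integrableOn_exp_mul_Ioi (neg_lt_zero.2 hc) a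
  have hval := integral_exp_mul_Ioi (neg_lt_zero.2 hc) a
  simp only [neg_mul] at hint hval
  rw [← ofReal_integral_eq_lintegral_ofReal hint
    (Eventually.of_forall fun t => (Real.exp_pos _).le), hval, neg_div_neg_eq]

lemma ae_pos_expMeasure_one : ∀ᵐ x ∂(expMeasure 1), 0 < x := by
  rw [ae_iff]
  have h : {x : ℝ | ¬ 0 < x} = Iic 0 := by ext; simp
  rw [h, ← lintegral_indicator_one measurableSet_Iic,
    lintegral_expMeasure_one _ (measurable_one.indicator measurableSet_Iic),
    setLIntegral_congr_fun measurableSet_Ioi (g := fun _ => 0)]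
  · simp
  · intro x hx
    simp [mem_Ioi.1 hx]

/-- This is the origin of the killing factor `1 / (1 + b w)` in the Green functions. -/
lemma lintegral_expMeasure_one_exp_neg_mul (c : ℝ≥0) :
    ∫⁻ x, ENNReal.ofReal (Real.exp (-(c * x))) ∂(expMeasure 1) = (1 + (c : ℝ≥0∞))⁻¹ := by
  rw [lintegral_expMeasure_one _ (by fun_prop)]
  have h : ∀ x : ℝ, ENNReal.ofReal (Real.exp (-x)) * ENNReal.ofReal (Real.exp (-(c * x)))
      = ENNReal.ofReal (Real.exp (-((1 + c) * x))) := by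
    intro x
    rw [← ENNReal.ofReal_mul (Real.exp_pos _).le, ← Real.exp_add]
    ring_nf
  simp only [h]
  rw [lintegral_exp_neg_mul_Ioi (by positivity), mul_zero, neg_zero, Real.exp_zero, one_div,
    ENNReal.ofReal_inv_of_pos (by positivity), ENNReal.ofReal_add zero_le_one (NNReal.coe_nonneg c)]
  simp

lemma expMeasure_one_Ioi {a : ℝ} (ha : 0 ≤ a) :
    expMeasure 1 (Ioi a) = ENNReal.ofReal (Real.exp (-a)) := by
  rw [← lintegral_indicator_one measurableSet_Ioi,
    lintegral_expMeasure_one _ (measurable_one.indicator measurableSet_Ioi)]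
  have h : ∀ x : ℝ, ENNReal.ofReal (Real.exp (-x)) * (Ioi a).indicator 1 x
      = (Ioi a).indicator (fun x => ENNReal.ofReal (Real.exp (-(1 * x)))) x := by
    intro x
    by_cases hx : x ∈ Ioi a <;> simp [hx]
  simp only [h]
  rw [lintegral_indicator measurableSet_Ioi, Measure.restrict_restrict measurableSet_Ioi,
    Ioi_inter_Ioi, sup_of_le_left ha, lintegral_exp_neg_mul_Ioi one_pos]
  simp

lemma lintegral_expMeasure_one_id : ∫⁻ x, ENNReal.ofReal x ∂(expMeasure 1) = 1 := by
  rw [lintegral_expMeasure_one _ (by fun_prop)]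
  have h : ∀ x : ℝ, ENNReal.ofReal (Real.exp (-x)) * ENNReal.ofReal x
      = ENNReal.ofReal (Real.exp (-x) * x) := fun x =>
    (ENNReal.ofReal_mul (Real.exp_pos _).le).symm
  simp only [h]
  have e : ∀ x ∈ Ioi (0 : ℝ), Real.exp (-x) * x ^ ((2 : ℝ) - 1) = Real.exp (-x) * x := by
    intro x _
    norm_num
  have hint := (Real.GammaIntegral_convergent (s := 2) (by norm_num)).congr_fun e measurableSet_Ioi
  have hval := Real.Gamma_eq_integral (s := 2) (by norm_num)
  rw [setIntegral_congr_fun measurableSet_Ioi e, Real.Gamma_two] at hval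
  rw [← ofReal_integral_eq_lintegral_ofReal hint, ← hval, ENNReal.ofReal_one]
  filter_upwards [ae_restrict_mem measurableSet_Ioi] with x hx
  have := mem_Ioi.1 hx
  simp only [Pi.zero_apply]
  positivity

/-- The law of a sequence of i.i.d. mean-one exponential variables. -/
def expSeq : Measure (ℕ → ℝ) := Measure.infinitePi fun _ : ℕ => expMeasure 1

instance : IsProbabilityMeasure expSeq := by
  unfold expSeq
  infer_instance

lemma expSeq_map_eval (n : ℕ) : expSeq.map (fun e => e n) = expMeasure 1 :=
  Measure.infinitePi_map_eval (fun _ : ℕ => expMeasure 1) n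

lemma ae_expSeq_pos : ∀ᵐ e ∂expSeq, ∀ n, 0 < e n := by
  rw [ae_all_iff]
  intro n
  have h := ae_pos_expMeasure_one
  rw [← expSeq_map_eval n] at h
  exact ae_of_ae_map (measurable_pi_apply n).aemeasurable h

lemma iIndepFun_expSeq (f : ℕ → ℝ → ℝ≥0∞) (hf : ∀ n, Measurable (f n)) :
    iIndepFun (fun n e => f n (e n)) expSeq :=
  iIndepFun_infinitePi hf

lemma lintegral_expSeq_prod_exp_neg (c : ℕ → ℝ≥0) (n : ℕ) :
    ∫⁻ e, ENNReal.ofReal (Real.exp (-(∑ i ∈ Finset.range n, c i * e i))) ∂expSeq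
      = ∏ i ∈ Finset.range n, (1 + (c i : ℝ≥0∞))⁻¹ := by
  have hm : ∀ i, Measurable fun x : ℝ => ENNReal.ofReal (Real.exp (-(c i * x))) := fun i => by
    fun_prop
  have h := lintegral_prod_eq_prod_lintegral_of_indepFun (μ := expSeq) (Finset.range n)
    (fun (i : ℕ) (e : ℕ → ℝ) => ENNReal.ofReal (Real.exp (-(c i * e i))))
    (iIndepFun_expSeq (fun i x => ENNReal.ofReal (Real.exp (-(c i * x)))) hm)
    (fun i => (hm i).comp (measurable_pi_apply i))
  calc _ = ∫⁻ e, ∏ i ∈ Finset.range n, ENNReal.ofReal (Real.exp (-(c i * e i))) ∂expSeq := by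
        refine lintegral_congr fun e => ?_
        rw [← ENNReal.ofReal_prod_of_nonneg fun i _ => (Real.exp_pos _).le, ← Real.exp_sum,
          Finset.sum_neg_distrib]
    _ = _ := by
        rw [h]
        refine Finset.prod_congr rfl fun i _ => ?_
        rw [← lintegral_expMeasure_one_exp_neg_mul, ← expSeq_map_eval i,
          lintegral_map (hm i) (measurable_pi_apply i)]

/-- The variable `e n` is independent of the sums of the preceding ones. -/
lemma lintegral_expSeq_sum_eval (c : ℕ → ℝ≥0) (n : ℕ) (f : ℝ → ℝ → ℝ≥0∞)
    (hf : Measurable (Function.uncurry f)) :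
    ∫⁻ e, f (∑ i ∈ Finset.range n, c i * e i) (e n) ∂expSeq
      = ∫⁻ e, ∫⁻ x, f (∑ i ∈ Finset.range n, c i * e i) x ∂(expMeasure 1) ∂expSeq := by
  have hind : IndepFun (fun (e : ℕ → ℝ) (i : Finset.range n) => e i)
      (fun (e : ℕ → ℝ) (i : ({n} : Finset ℕ)) => e i) expSeq :=
    (iIndepFun_infinitePi (P := fun _ : ℕ => expMeasure 1) (X := fun _ x => x)
      (fun _ => measurable_id)).indepFun_finset _ _ (by simp) (fun _ => by fun_prop)
  have hind2 : IndepFun (fun e : ℕ → ℝ => ∑ i ∈ Finset.range n, (c i : ℝ) * e i)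
      (fun e : ℕ → ℝ => e n) expSeq := by
    have hφ : Measurable fun x : Finset.range n → ℝ =>
        ∑ i : Finset.range n, (c (i : ℕ) : ℝ) * x i :=
      Finset.measurable_sum _ fun i _ => (measurable_pi_apply i).const_mul _
    have hψ : Measurable fun x : ({n} : Finset ℕ) → ℝ => x ⟨n, Finset.mem_singleton_self n⟩ :=
      measurable_pi_apply (X := fun _ : ({n} : Finset ℕ) => ℝ) ⟨n, Finset.mem_singleton_self n⟩
    have := hind.comp hφ hψ
    convert this using 1
    · funext e
      exact (Finset.sum_coe_sort (Finset.range n) fun i => (c i : ℝ) * e i).symm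
    · rfl
  have hS : Measurable fun e : ℕ → ℝ => ∑ i ∈ Finset.range n, (c i : ℝ) * e i :=
    Finset.measurable_sum _ fun i _ => (measurable_pi_apply i).const_mul _
  have hmap := hind2.map_prod_eq_prod_map_map hS.aemeasurable (measurable_pi_apply n).aemeasurable
  rw [expSeq_map_eval] at hmap
  have h := congrArg (fun m => ∫⁻ x, Function.uncurry f x ∂m) hmap
  rw [lintegral_map hf (hS.prodMk (measurable_pi_apply n)), lintegral_prod _ hf.aemeasurable,
    lintegral_map hf.lintegral_prod_right' hS] at h
  exact h

end Exponential

/-! ### Clocks with prescribed mean holding times -/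

section Clock

variable {E : Type*}

/-- The time elapsed before the `n`-th jump when state `ξ` is held for `w ξ` times an exponential
variable. -/
def clock (w : E → ℝ≥0) (n : ℕ) (ω : (ℕ → E) × (ℕ → ℝ)) : ℝ :=
  ∑ i ∈ Finset.range n, (w (ω.1 i) : ℝ) * ω.2 i

/-- The event that at time `t` the chain has made `n` jumps and sits in `ξ`. -/
def occupied (w : E → ℝ≥0) (ξ : E) (t : ℝ) (n : ℕ) : Set ((ℕ → E) × (ℕ → ℝ)) :=
  {ω | ω.1 n = ξ ∧ clock w n ω ≤ t ∧ t < clock w (n + 1) ω}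

lemma clock_zero (w : E → ℝ≥0) (ω : (ℕ → E) × (ℕ → ℝ)) : clock w 0 ω = 0 := rfl

lemma clock_succ (w : E → ℝ≥0) (n : ℕ) (ω : (ℕ → E) × (ℕ → ℝ)) :
    clock w (n + 1) ω = clock w n ω + w (ω.1 n) * ω.2 n :=
  Finset.sum_range_succ _ _

lemma clock_mono (w : E → ℝ≥0) (ω : (ℕ → E) × (ℕ → ℝ)) (hω : ∀ n, 0 < ω.2 n) :
    Monotone fun n => clock w n ω := by
  refine monotone_nat_of_le_succ fun n => ?_
  rw [clock_succ]
  exact le_add_of_nonneg_right (mul_nonneg (NNReal.coe_nonneg _) (hω n).le)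

variable [MeasurableSpace E] [DiscreteMeasurableSpace E]

lemma measurable_clock (w : E → ℝ≥0) (n : ℕ) : Measurable (clock w n) := by
  have hw : Measurable w := .of_discrete
  unfold clock
  refine Finset.measurable_sum _ fun i _ => Measurable.mul ?_ ?_
  · exact measurable_coe_nnreal_real.comp
      (hw.comp ((measurable_pi_apply i).comp measurable_fst))
  · exact (measurable_pi_apply i).comp measurable_snd

variable [Countable E]

lemma measurableSet_state_eq (n : ℕ) (ξ : E) :
    MeasurableSet {ω : (ℕ → E) × (ℕ → ℝ) | ω.1 n = ξ} :=
  measurableSet_eq_fun ((measurable_pi_apply n).comp measurable_fst) measurable_const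

lemma measurableSet_occupied (w : E → ℝ≥0) (ξ : E) (t : ℝ) (n : ℕ) :
    MeasurableSet (occupied w ξ t n) :=
  (measurableSet_state_eq n ξ).inter
    ((measurableSet_le (measurable_clock w n) measurable_const).inter
      (measurableSet_lt measurable_const (measurable_clock w (n + 1))))

end Clock

/-- The probability that a state entered at time `s`, with mean holding time `a`, is still occupied
at time `t`. -/
def holdProb (a : ℝ≥0) (t s : ℝ) : ℝ≥0∞ :=
  if s ≤ t then ENNReal.ofReal (Real.exp (-((t - s) / a))) else 0

lemma measurable_holdProb (a : ℝ≥0) : Measurable (Function.uncurry (holdProb a)) := by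
  unfold holdProb
  exact Measurable.ite (measurableSet_le measurable_snd measurable_fst) (by fun_prop)
    measurable_const

lemma lintegral_expMeasure_one_hold {a : ℝ≥0} (ha : a ≠ 0) (t s : ℝ) :
    ∫⁻ x, (if s ≤ t ∧ t < s + a * x then 1 else 0) ∂(expMeasure 1) = holdProb a t s := by
  unfold holdProb
  by_cases hs : s ≤ t
  · have ha' : (0 : ℝ) < a := by positivity
    have h : ∀ x : ℝ, (if s ≤ t ∧ t < s + a * x then (1 : ℝ≥0∞) else 0)
        = (Ioi ((t - s) / a)).indicator 1 x := by
      intro x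
      have : (s ≤ t ∧ t < s + a * x) ↔ x ∈ Ioi ((t - s) / a) := by
        rw [mem_Ioi, div_lt_iff₀ ha']
        constructor
        · rintro ⟨_, h⟩; linarith
        · intro h; exact ⟨hs, by linarith⟩
      by_cases hx : x ∈ Ioi ((t - s) / a)
      · simp [this.2 hx, hx, -mem_Ioi]
      · simp only [this, hx, if_false, not_false_eq_true, indicator_of_notMem]
    simp only [h]
    rw [if_pos hs, lintegral_indicator_one measurableSet_Ioi,
      expMeasure_one_Ioi (div_nonneg (sub_nonneg.2 hs) ha'.le)]
  · simp [hs]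

/-- By lack of memory, a state occupied at `s` is still occupied at `t` with probability
`e^{-(t-s)/a}`. This one-sided bound survives infinite sums, which is how it is used later. -/
lemma holdProb_mul_le (a : ℝ≥0) {s t r : ℝ} (hst : s ≤ t) :
    holdProb a s r * ENNReal.ofReal (Real.exp (-((t - s) / a))) ≤ holdProb a t r := by
  unfold holdProb
  by_cases h : r ≤ s
  · rw [if_pos h, if_pos (h.trans hst), ← ENNReal.ofReal_mul (Real.exp_pos _).le, ← Real.exp_add]
    ring_nf
    exact le_rfl
  · simp [h]

lemma lintegral_exp_neg_mul_holdProb {a : ℝ≥0} (ha : a ≠ 0) (b : ℝ≥0) {s : ℝ} (hs : 0 ≤ s) :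
    ∫⁻ t in Ioi 0, ENNReal.ofReal (Real.exp (-(b * t))) * holdProb a t s
      = ENNReal.ofReal (Real.exp (-(b * s))) * (a * (1 + ((b * a : ℝ≥0) : ℝ≥0∞))⁻¹) := by
  have ha' : (0 : ℝ) < a := by positivity
  have h : ∀ t : ℝ, ENNReal.ofReal (Real.exp (-(b * t))) * holdProb a t s
      = (Ici s).indicator (fun t => ENNReal.ofReal (Real.exp (s / a))
        * ENNReal.ofReal (Real.exp (-((b + 1 / a) * t)))) t := by
    intro t
    unfold holdProb
    by_cases hst : s ≤ t
    · rw [if_pos hst, indicator_of_mem (mem_Ici.2 hst),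
        ← ENNReal.ofReal_mul (Real.exp_pos _).le, ← ENNReal.ofReal_mul (Real.exp_pos _).le,
        ← Real.exp_add, ← Real.exp_add]
      congr 2
      field_simp
      ring
    · rw [if_neg hst, indicator_of_notMem (by simpa using hst), mul_zero]
  simp only [h]
  have hab : (0 : ℝ) < b + 1 / a := by positivity
  rw [setLIntegral_congr Ioi_ae_eq_Ici, lintegral_indicator measurableSet_Ici,
    Measure.restrict_restrict measurableSet_Ici, Ici_inter_Ici, sup_of_le_left hs,
    ← setLIntegral_congr Ioi_ae_eq_Ici, lintegral_const_mul _ (by fun_prop),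
    lintegral_exp_neg_mul_Ioi hab, ← ENNReal.ofReal_mul (Real.exp_pos _).le]
  have e1 : (1 : ℝ≥0∞) + ((b * a : ℝ≥0) : ℝ≥0∞) = ENNReal.ofReal (1 + b * a) := by
    rw [ENNReal.ofReal_add zero_le_one (by positivity), ENNReal.ofReal_one]
    congr 1
    rw [← NNReal.coe_mul, ENNReal.ofReal_coe_nnreal]
  have e2 : (a : ℝ≥0∞) = ENNReal.ofReal a := ENNReal.ofReal_coe_nnreal.symm
  rw [e1, e2, ← ENNReal.ofReal_inv_of_pos (by positivity),
    ← ENNReal.ofReal_mul ha'.le, ← ENNReal.ofReal_mul (Real.exp_pos _).le]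
  congr 1
  rw [← mul_div_assoc, ← Real.exp_add, show s / a + -((b + 1 / a) * s) = -(b * s) by ring]
  field_simp
  ring

/-! ### Laplace transform of the occupation probabilities -/

namespace RateMatrix

variable {E : Type*} (R : RateMatrix E)
variable [Countable E] [MeasurableSpace E] [DiscreteMeasurableSpace E]

lemma law_eq (η : E) : R.law η = (R.chainLaw η).prod expSeq := rfl

instance (η : E) : IsProbabilityMeasure (R.law η) := by
  rw [law_eq]
  infer_instance

lemma ae_law_fst {η : E} {P : (ℕ → E) → Prop} (h : ∀ᵐ y ∂(R.chainLaw η), P y) :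
    ∀ᵐ ω ∂(R.law η), P ω.1 :=
  Measure.quasiMeasurePreserving_fst.ae h

lemma ae_law_snd {η : E} {P : (ℕ → ℝ) → Prop} (h : ∀ᵐ e ∂expSeq, P e) :
    ∀ᵐ ω ∂(R.law η), P ω.2 :=
  Measure.quasiMeasurePreserving_snd.ae h

lemma ae_law_pos (η : E) : ∀ᵐ ω ∂(R.law η), ∀ n, 0 < ω.2 n := R.ae_law_snd ae_expSeq_pos

lemma ae_law_zero (η : E) : ∀ᵐ ω ∂(R.law η), ω.1 0 = η := R.ae_law_fst (R.ae_chainLaw_zero η)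

variable (w : E → ℝ≥0)

open Classical in
lemma law_occupied (η ξ : E) (hξ : w ξ ≠ 0) (t : ℝ) (n : ℕ) :
    R.law η (occupied w ξ t n)
      = ∫⁻ ω, (if ω.1 n = ξ then 1 else 0) * holdProb (w ξ) t (clock w n ω) ∂(R.law η) := by
  have hm : Measurable fun ω : (ℕ → E) × (ℕ → ℝ) =>
      (if ω.1 n = ξ then (1 : ℝ≥0∞) else 0) * holdProb (w ξ) t (clock w n ω) := by
    refine Measurable.mul (Measurable.ite (measurableSet_state_eq n ξ) measurable_const
      measurable_const) ?_
    exact (measurable_holdProb (w ξ)).comp (measurable_const.prodMk (measurable_clock w n))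
  rw [← lintegral_indicator_one (measurableSet_occupied w ξ t n), law_eq,
    lintegral_prod _ (measurable_one.indicator (measurableSet_occupied w ξ t n)).aemeasurable,
    lintegral_prod _ hm.aemeasurable]
  refine lintegral_congr fun y => ?_
  by_cases hy : y n = ξ
  · have h := lintegral_expSeq_sum_eval (fun i => w (y i)) n
      (fun s x => if s ≤ t ∧ t < s + w ξ * x then 1 else 0)
      (Measurable.ite ((measurableSet_le measurable_fst measurable_const).inter
        (measurableSet_lt measurable_const
          (measurable_fst.add (measurable_snd.const_mul (w ξ : ℝ)))))
        measurable_const measurable_const)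
    simp only [lintegral_expMeasure_one_hold hξ] at h
    simp only [hy, if_true, one_mul]
    refine Eq.trans (lintegral_congr fun e => ?_) h
    simp only [indicator_apply, occupied, mem_ofPred_eq, hy, true_and, clock_succ, Pi.one_apply]
    rfl
  · simp [hy, occupied]

lemma law_occupied_mul_le (η ξ : E) (hξ : w ξ ≠ 0) {s t : ℝ} (hst : s ≤ t) (n : ℕ) :
    R.law η (occupied w ξ s n) * ENNReal.ofReal (Real.exp (-((t - s) / w ξ)))
      ≤ R.law η (occupied w ξ t n) := by
  classical
  rw [R.law_occupied w η ξ hξ, R.law_occupied w η ξ hξ,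
    ← lintegral_mul_const' _ _ ENNReal.ofReal_ne_top]
  refine lintegral_mono fun ω => ?_
  simp only
  rw [mul_assoc]
  gcongr
  exact holdProb_mul_le _ hst

/-- Integrate over `t` first: the current sojourn gives `w ξ / (1 + b w ξ)`, and the mean of `e^{-b
* clock}` gives one factor `1 / (1 + b w)` for each completed one. States with `w = 0` contribute a
factor one. -/
lemma lintegral_exp_neg_law_occupied (η ξ : E) (hξ : w ξ ≠ 0) (b : ℝ≥0) (n : ℕ) :
    ∫⁻ t in Ioi 0, ENNReal.ofReal (Real.exp (-(b * t))) * R.law η (occupied w ξ t n)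
      = killedPower R.jumpMatrix (fun ζ => (1 + ((b * w ζ : ℝ≥0) : ℝ≥0∞))⁻¹) n η ξ * w ξ := by
  classical
  have hi : Measurable fun ω : (ℕ → E) × (ℕ → ℝ) => (if ω.1 n = ξ then (1 : ℝ≥0∞) else 0) :=
    Measurable.ite (measurableSet_state_eq n ξ) measurable_const measurable_const
  have hh : Measurable fun x : ℝ × ((ℕ → E) × (ℕ → ℝ)) =>
      holdProb (w ξ) x.1 (clock w n x.2) :=
    (measurable_holdProb (w ξ)).comp
      (measurable_fst.prodMk ((measurable_clock w n).comp measurable_snd))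
  have hf : Measurable fun x : ℝ × ((ℕ → E) × (ℕ → ℝ)) =>
      ENNReal.ofReal (Real.exp (-(b * x.1)))
        * ((if x.2.1 n = ξ then 1 else 0) * holdProb (w ξ) x.1 (clock w n x.2)) :=
    Measurable.mul (by fun_prop) ((hi.comp measurable_snd).mul hh)
  simp only [R.law_occupied w η ξ hξ, ← lintegral_const_mul' _ _ ENNReal.ofReal_ne_top]
  rw [lintegral_lintegral_swap hf.aemeasurable]
  have h1 : ∀ᵐ ω ∂(R.law η), ∫⁻ t in Ioi 0, ENNReal.ofReal (Real.exp (-(b * t)))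
        * ((if ω.1 n = ξ then 1 else 0) * holdProb (w ξ) t (clock w n ω))
      = (if ω.1 n = ξ then 1 else 0) * ENNReal.ofReal (Real.exp (-(b * clock w n ω)))
        * (w ξ * (1 + ((b * w ξ : ℝ≥0) : ℝ≥0∞))⁻¹) := by
    filter_upwards [R.ae_law_pos η] with ω hω
    have h0 : 0 ≤ clock w n ω := by
      have := clock_mono w ω hω (Nat.zero_le n)
      simpa [clock_zero] using this
    simp only [mul_left_comm _ (if ω.1 n = ξ then (1 : ℝ≥0∞) else 0)]
    rw [lintegral_const_mul' _ _ (by split_ifs <;> simp), lintegral_exp_neg_mul_holdProb hξ b h0,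
      mul_assoc]
  rw [lintegral_congr_ae h1, lintegral_mul_const']
  swap
  · exact ENNReal.mul_ne_top ENNReal.coe_ne_top (by simp)
  have hm2 : Measurable fun ω : (ℕ → E) × (ℕ → ℝ) => (if ω.1 n = ξ then (1 : ℝ≥0∞) else 0)
      * ENNReal.ofReal (Real.exp (-(b * clock w n ω))) :=
    hi.mul (((measurable_clock w n).const_mul _).neg.exp.ennreal_ofReal)
  rw [law_eq, lintegral_prod _ hm2.aemeasurable, ← R.lintegral_chainLaw_prod,
    mul_comm (w ξ : ℝ≥0∞), ← mul_assoc, ← lintegral_mul_const' _ _ (by simp)]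
  congr 1
  refine lintegral_congr fun y => ?_
  have h2 := lintegral_expSeq_prod_exp_neg (fun i => b * w (y i)) n
  have h3 : ∀ e : ℕ → ℝ, ∑ i ∈ Finset.range n, ((b * w (y i) : ℝ≥0) : ℝ) * e i
      = b * clock w n (y, e) := by
    intro e
    unfold clock
    rw [Finset.mul_sum]
    refine Finset.sum_congr rfl fun i _ => ?_
    push_cast
    ring
  simp only [h3] at h2
  by_cases hy : y n = ξ
  · simp only [hy, if_true, one_mul, mul_one, h2, Finset.prod_range_succ]
  · simp [hy]

end RateMatrix

/-! ### Divergence of the clock -/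

section Clock

variable {E : Type*}

lemma exists_clock_le_lt (w : E → ℝ≥0) (ω : (ℕ → E) × (ℕ → ℝ)) {t : ℝ} (ht : 0 ≤ t)
    (h : ∃ n, t < clock w n ω) : ∃ n, clock w n ω ≤ t ∧ t < clock w (n + 1) ω := by
  classical
  have hpos : Nat.find h ≠ 0 := by
    intro h0
    have := Nat.find_spec h
    rw [h0, clock_zero] at this
    linarith
  obtain ⟨n, hn⟩ := Nat.exists_eq_succ_of_ne_zero hpos
  refine ⟨n, not_lt.1 (Nat.find_min h (by omega)), ?_⟩
  have := Nat.find_spec h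
  rwa [hn] at this

lemma clock_index_unique (w : E → ℝ≥0) (ω : (ℕ → E) × (ℕ → ℝ)) (hω : ∀ n, 0 < ω.2 n) {t : ℝ}
    {m n : ℕ} (hm : clock w m ω ≤ t) (hm' : t < clock w (m + 1) ω) (hn : clock w n ω ≤ t)
    (hn' : t < clock w (n + 1) ω) : m = n := by
  have hmono := clock_mono w ω hω
  by_contra hne
  rcases Nat.lt_or_gt_of_ne hne with h | h
  · have : clock w (m + 1) ω ≤ clock w n ω := hmono h
    linarith
  · have : clock w (n + 1) ω ≤ clock w m ω := hmono h
    linarith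

lemma exists_prod_le_pow {c : ℕ → ℝ≥0∞} {a : ℝ≥0∞} (hc : ∀ n, c n ≤ 1)
    (h : ∃ᶠ n in atTop, c n = a) (k : ℕ) : ∃ N, ∏ i ∈ Finset.range N, c i ≤ a ^ k := by
  induction k with
  | zero => exact ⟨0, by simp⟩
  | succ k ih =>
    obtain ⟨N, hN⟩ := ih
    obtain ⟨n, hn, hna⟩ := frequently_atTop.1 h N
    refine ⟨n + 1, ?_⟩
    rw [Finset.prod_range_succ, hna, pow_succ]
    gcongr
    refine le_trans ?_ hN
    rw [← Finset.prod_range_mul_prod_Ico _ hn]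
    exact mul_le_of_le_one_right' (Finset.prod_le_one' fun i _ => hc i)

/-- The mean of `e^{-clock}` is a product in which the factor `1 / (1 + w η) < 1` occurs infinitely
often, so the infimum of `e^{-clock}` has mean zero. -/
lemma ae_exists_lt_clock (w : E → ℝ≥0) (y : ℕ → E) (η : E) (hη : w η ≠ 0)
    (hy : ∃ᶠ n in atTop, y n = η) : ∀ᵐ e ∂expSeq, ∀ t, ∃ n, t < clock w n (y, e) := by
  set L : (ℕ → ℝ) → ℝ≥0∞ := fun e => ⨅ n, ENNReal.ofReal (Real.exp (-clock w n (y, e))) with hL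
  have hm : ∀ n, Measurable fun e : ℕ → ℝ => clock w n (y, e) := fun n =>
    Finset.measurable_sum _ fun i _ =>
      show Measurable fun e : ℕ → ℝ => (w (y i) : ℝ) * e i by fun_prop
  have hLm : Measurable L := .iInf fun n => (hm n).neg.exp.ennreal_ofReal
  have hle : ∀ n, ∫⁻ e, L e ∂expSeq ≤ ∏ i ∈ Finset.range n, (1 + (w (y i) : ℝ≥0∞))⁻¹ := by
    intro n
    rw [← lintegral_expSeq_prod_exp_neg fun i => w (y i)]
    exact lintegral_mono fun e => iInf_le _ n
  set a : ℝ≥0∞ := (1 + (w η : ℝ≥0∞))⁻¹ with ha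
  have ha1 : a < 1 := by
    rw [ha, ENNReal.inv_lt_one]
    exact ENNReal.lt_add_right (by simp) (by simpa using hη)
  have hzero : ∫⁻ e, L e ∂expSeq = 0 := by
    refine le_antisymm (ge_of_tendsto' (ENNReal.tendsto_pow_atTop_nhds_zero_of_lt_one ha1)
      fun k => ?_) zero_le
    obtain ⟨N, hN⟩ := exists_prod_le_pow (c := fun i => (1 + (w (y i) : ℝ≥0∞))⁻¹) (a := a)
      (fun n => by simp) (hy.mono fun n hn => by simp only [hn, ha]) k
    exact (hle N).trans hN
  filter_upwards [(lintegral_eq_zero_iff hLm).1 hzero] with e he t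
  by_contra! hcon
  have h1 : ENNReal.ofReal (Real.exp (-t)) ≤ L e :=
    le_iInf fun n => ENNReal.ofReal_le_ofReal (Real.exp_le_exp.2 (neg_le_neg (hcon n)))
  rw [he] at h1
  have := Real.exp_pos (-t)
  simp at h1
  linarith

end Clock

/-! ### The transition function of the chain with holding times `w` -/

namespace RateMatrix

variable {E : Type*} (R : RateMatrix E)
variable [Countable E] [MeasurableSpace E] [DiscreteMeasurableSpace E]
variable (w : E → ℝ≥0)

lemma ChainRecurrent.ae_exists_lt_clock (hrec : R.ChainRecurrent) {η : E} (hη : w η ≠ 0) :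
    ∀ᵐ ω ∂(R.law η), ∀ t, ∃ n, t < clock w n ω := by
  have hset : {ω : (ℕ → E) × (ℕ → ℝ) | ∀ t, ∃ n, t < clock w n ω}
      = ⋂ k : ℕ, ⋃ n, {ω | (k : ℝ) < clock w n ω} := by
    ext ω
    simp only [mem_ofPred_eq, mem_iInter, mem_iUnion]
    refine ⟨fun h k => h k, fun h t => ?_⟩
    obtain ⟨k, hk⟩ := exists_nat_ge t
    obtain ⟨n, hn⟩ := h k
    exact ⟨n, hk.trans_lt hn⟩
  have hmeas : MeasurableSet {ω : (ℕ → E) × (ℕ → ℝ) | ∀ t, ∃ n, t < clock w n ω} := by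
    rw [hset]
    exact .iInter fun k => .iUnion fun n => measurableSet_lt measurable_const (measurable_clock w n)
  rw [law_eq, Measure.ae_prod_iff_ae_ae hmeas]
  filter_upwards [hrec η] with y hy
  exact _root_.ae_exists_lt_clock w y η hη hy

/-- The probability that at time `t` the chain started from `η` sits in `ξ`, when state `ζ` is held
for `w ζ` times an exponential variable. -/
def transition (η ξ : E) (t : ℝ) : ℝ≥0∞ := ∑' n, R.law η (occupied w ξ t n)

lemma measurable_law_occupied (η ξ : E) (n : ℕ) :
    Measurable fun t => R.law η (occupied w ξ t n) := by
  have hs : MeasurableSet {x : ℝ × ((ℕ → E) × (ℕ → ℝ)) |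
      x.2.1 n = ξ ∧ clock w n x.2 ≤ x.1 ∧ x.1 < clock w (n + 1) x.2} :=
    (measurable_snd (measurableSet_state_eq n ξ)).inter
      ((measurableSet_le ((measurable_clock w n).comp measurable_snd) measurable_fst).inter
        (measurableSet_lt measurable_fst ((measurable_clock w (n + 1)).comp measurable_snd)))
  exact measurable_measure_prodMk_left hs

lemma measurable_transition (η ξ : E) : Measurable (R.transition w η ξ) :=
  Measurable.tsum fun n => R.measurable_law_occupied w η ξ n

lemma law_iUnion_occupied (η ξ : E) (t : ℝ) :
    R.law η (⋃ n, occupied w ξ t n) = R.transition w η ξ t := by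
  refine measure_iUnion₀ (fun m n hmn => ?_)
    fun n => (measurableSet_occupied w ξ t n).nullMeasurableSet
  refine measure_mono_null (t := {ω | ¬ ∀ n, 0 < ω.2 n}) ?_ (R.ae_law_pos η)
  rintro ω ⟨h1, h2⟩ hω
  exact hmn (clock_index_unique w ω hω h1.2.1 h1.2.2 h2.2.1 h2.2.2)

/-- Common entry point for the original process and its trace: only the position during each sojourn
matters. Starting where `w η ≠ 0` makes the clock diverge, so every `t ≥ 0` lies in a sojourn. -/
lemma law_eq_transition (hrec : R.ChainRecurrent) {η : E} (hη : w η ≠ 0) {t : ℝ} (ht : 0 ≤ t)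
    (X : (ℕ → E) × (ℕ → ℝ) → E)
    (hX : ∀ᵐ ω ∂(R.law η), ∀ n, clock w n ω ≤ t → t < clock w (n + 1) ω → X ω = ω.1 n) (ξ : E) :
    R.law η {ω | X ω = ξ} = R.transition w η ξ t := by
  rw [← law_iUnion_occupied]
  refine measure_congr ?_
  filter_upwards [hX, hrec.ae_exists_lt_clock R w hη] with ω h1 h2
  refine propext ⟨fun h => ?_, fun h => ?_⟩
  · obtain ⟨n, hn, hn'⟩ := exists_clock_le_lt w ω ht (h2 t)
    exact mem_iUnion.2 ⟨n, (h1 n hn hn').symm.trans h, hn, hn'⟩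
  · obtain ⟨n, hn⟩ := mem_iUnion.1 h
    exact (h1 n hn.2.1 hn.2.2).trans hn.1

lemma transition_mul_le (η ξ : E) (hξ : w ξ ≠ 0) {s t : ℝ} (hst : s ≤ t) :
    R.transition w η ξ s * ENNReal.ofReal (Real.exp (-((t - s) / w ξ)))
      ≤ R.transition w η ξ t := by
  unfold transition
  rw [← ENNReal.tsum_mul_right]
  exact ENNReal.tsum_le_tsum fun n => R.law_occupied_mul_le w η ξ hξ hst n

lemma lintegral_exp_neg_transition (η ξ : E) (hξ : w ξ ≠ 0) (b : ℝ≥0) :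
    ∫⁻ t in Ioi 0, ENNReal.ofReal (Real.exp (-(b * t))) * R.transition w η ξ t
      = green R.jumpMatrix (fun ζ => (1 + ((b * w ζ : ℝ≥0) : ℝ≥0∞))⁻¹) η ξ * w ξ := by
  unfold transition green
  simp only [← ENNReal.tsum_mul_left, ← ENNReal.tsum_mul_right]
  rw [lintegral_tsum]
  · simp only [R.lintegral_exp_neg_law_occupied w η ξ hξ b]
  · intro n
    have := R.measurable_law_occupied w η ξ n
    exact (Measurable.mul (by fun_prop) this).aemeasurable

/-- Sojourns are intervals closed on the left and open on the right, so almost surely the indicator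
of sitting in `ξ` is right-continuous. -/
lemma tendsto_transition (hrec : R.ChainRecurrent) {η : E} (hη : w η ≠ 0) (ξ : E) {t : ℝ}
    (ht : 0 ≤ t) :
    Tendsto (R.transition w η ξ) (nhdsWithin t (Ioi t)) (nhds (R.transition w η ξ t)) := by
  have hm : ∀ s, MeasurableSet (⋃ n, occupied w ξ s n) := fun s =>
    .iUnion fun n => measurableSet_occupied w ξ s n
  have : R.transition w η ξ = fun s => R.law η (⋃ n, occupied w ξ s n) := by
    funext s
    rw [law_iUnion_occupied]
  rw [this]
  refine tendsto_measure_of_ae_tendsto_indicator_of_isFiniteMeasure _ (hm t) hm ?_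
  filter_upwards [hrec.ae_exists_lt_clock R w hη, R.ae_law_pos η] with ω h1 h2
  obtain ⟨n, hn, hn'⟩ := exists_clock_le_lt w ω ht (h1 t)
  have hmem : ∀ s, clock w n ω ≤ s → s < clock w (n + 1) ω →
      (ω ∈ ⋃ n, occupied w ξ s n ↔ ω.1 n = ξ) := by
    intro s hs hs'
    refine ⟨fun h => ?_, fun h => mem_iUnion.2 ⟨n, h, hs, hs'⟩⟩
    obtain ⟨m, hm⟩ := mem_iUnion.1 h
    rw [← clock_index_unique w ω h2 hm.2.1 hm.2.2 hs hs']
    exact hm.1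
  filter_upwards [Ioo_mem_nhdsGT hn'] with s hs
  rw [hmem t hn hn', hmem s (hn.trans hs.1.le) hs.2]

open Classical in
lemma transition_zero {η : E} (hη : w η ≠ 0) (ξ : E) :
    R.transition w η ξ 0 = if η = ξ then 1 else 0 := by
  rw [← law_iUnion_occupied]
  have h : ∀ᵐ ω ∂(R.law η), (ω ∈ ⋃ n, occupied w ξ 0 n ↔ η = ξ) := by
    filter_upwards [R.ae_law_pos η, R.ae_law_zero η] with ω h1 h2
    have h3 : 0 < clock w (0 + 1) ω := by
      rw [clock_succ, clock_zero, h2, zero_add]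
      have := h1 0
      positivity
    rw [mem_iUnion]
    refine ⟨fun ⟨n, hn⟩ => ?_, fun h => ⟨0, h2.trans h, (clock_zero w ω).le, h3⟩⟩
    rw [← clock_index_unique w ω h1 (clock_zero w ω).le h3 hn.2.1 hn.2.2, ← h2] at *
    exact hn.1
  by_cases hηξ : η = ξ
  · rw [if_pos hηξ, prob_compl_eq_zero_iff₀ _ |>.1]
    · exact h.mono fun ω hω => hω.2 hηξ
    · exact NullMeasurableSet.iUnion fun n => (measurableSet_occupied w ξ 0 n).nullMeasurableSet
  · rw [if_neg hηξ]
    exact measure_eq_zero_iff_ae_notMem.2 (h.mono fun ω hω hmem => hηξ (hω.1 hmem))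

end RateMatrix

/-! ### From almost every time to every time -/

section RealAnalysis

lemma exists_mem_Ioo_of_ae {P : ℝ → Prop} (h : ∀ᵐ t ∂(volume.restrict (Ioi (0 : ℝ))), P t)
    {l u : ℝ} (hl : 0 ≤ l) (hlu : l < u) : ∃ s ∈ Ioo l u, P s := by
  rw [ae_restrict_iff' measurableSet_Ioi] at h
  by_contra! hcon
  have h1 : volume (Ioo l u) ≤ 0 := by
    rw [← ae_iff.1 h]
    exact measure_mono fun s hs => by
      simpa [hl.trans_lt hs.1] using hcon s hs
  rw [Real.volume_Ioo] at h1
  simp at h1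
  linarith

/-- A function which loses mass at most exponentially fast and is a.e. constant is constant. -/
lemma eq_const_of_ae_of_mul_exp_le {f : ℝ → ℝ≥0∞} {c : ℝ≥0∞} {a : ℝ}
    (hf : ∀ s t, s ≤ t → f s * ENNReal.ofReal (Real.exp (-((t - s) / a))) ≤ f t)
    (h : f =ᵐ[volume.restrict (Ioi 0)] fun _ => c) {t : ℝ} (ht : 0 < t) : f t = c := by
  apply le_antisymm
  -- A value above `c` at `t` would persist just after `t`, where `c` is attained.
  · by_contra! hlt
    have hcont : Tendsto (fun s : ℝ => f t * ENNReal.ofReal (Real.exp (-((s - t) / a))))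
        (nhds t) (nhds (f t * ENNReal.ofReal (Real.exp (-((t - t) / a))))) := by
      refine ENNReal.Tendsto.const_mul ?_ (Or.inl (by simp))
      exact ENNReal.tendsto_ofReal (Continuous.tendsto (by fun_prop) t)
    simp only [sub_self, zero_div, neg_zero, Real.exp_zero, ENNReal.ofReal_one, mul_one] at hcont
    have hev := hcont.eventually (lt_mem_nhds hlt)
    obtain ⟨u, hu, hsub⟩ := mem_nhdsGE_iff_exists_Ico_subset.1 (nhdsWithin_le_nhds hev)
    obtain ⟨s, hs, hfs⟩ := exists_mem_Ioo_of_ae h ht.le hu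
    have h1 : c < f t * ENNReal.ofReal (Real.exp (-((s - t) / a))) := hsub ⟨hs.1.le, hs.2⟩
    have h2 := hf t s hs.1.le
    rw [hfs] at h2
    exact absurd h1 h2.not_gt
  -- Just before `t` the value `c` is attained and can decay only slightly by time `t`; having times
  -- before `t` requires `0 < t`.
  · by_contra! hlt
    have hcont : Tendsto (fun s : ℝ => c * ENNReal.ofReal (Real.exp (-((t - s) / a))))
        (nhds t) (nhds (c * ENNReal.ofReal (Real.exp (-((t - t) / a))))) := by
      refine ENNReal.Tendsto.const_mul ?_ (Or.inl (by simp))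
      exact ENNReal.tendsto_ofReal (Continuous.tendsto (by fun_prop) t)
    simp only [sub_self, zero_div, neg_zero, Real.exp_zero, ENNReal.ofReal_one, mul_one] at hcont
    have hev := hcont.eventually (lt_mem_nhds hlt)
    obtain ⟨l, hl, hsub⟩ := (mem_nhdsLE_iff_exists_Ioc_subset' ht).1 (nhdsWithin_le_nhds hev)
    obtain ⟨s, hs, hfs⟩ := exists_mem_Ioo_of_ae h (le_max_right l 0) (max_lt hl ht)
    have h1 : f t < c * ENNReal.ofReal (Real.exp (-((t - s) / a))) :=
      hsub ⟨(le_max_left _ _).trans_lt hs.1, hs.2.le⟩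
    have h2 := hf s t hs.2.le
    rw [hfs] at h2
    exact absurd h1 h2.not_gt

lemma eq_of_ae_of_tendsto_nhdsGT {f g : ℝ → ℝ≥0∞} (h : f =ᵐ[volume.restrict (Ioi 0)] g) {t : ℝ}
    (ht : 0 ≤ t) (hf : Tendsto f (nhdsWithin t (Ioi t)) (nhds (f t)))
    (hg : Tendsto g (nhdsWithin t (Ioi t)) (nhds (g t))) : f t = g t := by
  refine tendsto_nhds_unique_of_frequently_eq hf hg fun hev => ?_
  obtain ⟨u, hu, hsub⟩ := mem_nhdsGT_iff_exists_Ioo_subset.1 hev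
  obtain ⟨s, hs, hfs⟩ := exists_mem_Ioo_of_ae h ht hu
  exact hsub hs hfs

end RealAnalysis

/-! ### Invariance and reversibility: from the kernel to the process and back -/

namespace RateMatrix

variable {E : Type*} (R : RateMatrix E)
variable [Countable E] [MeasurableSpace E] [DiscreteMeasurableSpace E]
variable (w : E → ℝ≥0)

/-- The Laplace transform of the flow of the measure `w σ` under the transition function. -/
lemma lintegral_exp_neg_tsum_transition (σ : E → ℝ≥0) (ξ : E) (hξ : w ξ ≠ 0) (b : ℝ≥0) :
    ∫⁻ t in Ioi 0, ENNReal.ofReal (Real.exp (-(b * t)))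
        * ∑' η, (σ η : ℝ≥0∞) * w η * R.transition w η ξ t
      = (∑' η, (σ η : ℝ≥0∞) * w η
        * green R.jumpMatrix (fun ζ => (1 + ((b * w ζ : ℝ≥0) : ℝ≥0∞))⁻¹) η ξ) * w ξ := by
  simp only [← ENNReal.tsum_mul_left, ← ENNReal.tsum_mul_right]
  rw [lintegral_tsum]
  · refine tsum_congr fun η => ?_
    rw [mul_assoc, ← R.lintegral_exp_neg_transition w η ξ hξ b, ← lintegral_const_mul']
    · refine lintegral_congr fun t => ?_
      ring
    · finiteness
  · intro η
    have := R.measurable_transition w η ξ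
    exact (Measurable.mul (by fun_prop) (this.const_mul _)).aemeasurable

lemma lintegral_exp_neg_const (k : ℕ) (c : ℝ≥0∞) :
    ∫⁻ t in Ioi (0 : ℝ), ENNReal.ofReal (Real.exp (-((k + 1) * t))) * c
      = ((k + 1 : ℝ≥0) : ℝ≥0∞)⁻¹ * c := by
  have hk : (0 : ℝ) < k + 1 := by positivity
  rw [lintegral_mul_const _ (by fun_prop), lintegral_exp_neg_mul_Ioi hk]
  congr 1
  rw [mul_zero, neg_zero, Real.exp_zero, one_div, ENNReal.ofReal_inv_of_pos hk]
  congr 1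
  rw [← ENNReal.ofReal_coe_nnreal]
  simp

lemma tsum_green_of_transition_invariant (σ : E → ℝ≥0) (hw : ∀ ξ, w ξ ≠ 0)
    (h : ∀ t : ℝ, 0 ≤ t → ∀ ξ, ∑' η, (σ η : ℝ≥0∞) * w η * R.transition w η ξ t = σ ξ * w ξ) (ξ : E) :
    ∑' η, (σ η : ℝ≥0∞) * w η * green R.jumpMatrix (fun ζ => (1 + (w ζ : ℝ≥0∞))⁻¹) η ξ = σ ξ := by
  have h1 := R.lintegral_exp_neg_tsum_transition w σ ξ (hw ξ) 1
  rw [setLIntegral_congr_fun measurableSet_Ioi (g := fun t =>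
    ENNReal.ofReal (Real.exp (-(((0 : ℕ) + 1) * t))) * ((σ ξ : ℝ≥0∞) * w ξ)) (fun t ht => by
      simp only [h t (mem_Ioi.1 ht).le]; simp), lintegral_exp_neg_const] at h1
  simp only [one_mul, Nat.cast_zero, zero_add, ENNReal.coe_one, inv_one] at h1
  exact ((ENNReal.mul_left_inj (by simpa using hw ξ) ENNReal.coe_ne_top).1 h1).symm

/-- If `σ` is invariant for the jump chain, then `σ w` is invariant for the transition function. -/
lemma transition_invariant (hrec : R.ChainRecurrent) (σ : E → ℝ≥0)
    (h : ∀ ξ, ∑' ζ, (σ ζ : ℝ≥0∞) * R.jumpMatrix ζ ξ = σ ξ) (ξ : E) (hξ : w ξ ≠ 0) {t : ℝ}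
    (ht : 0 ≤ t) : ∑' η, (σ η : ℝ≥0∞) * w η * R.transition w η ξ t = σ ξ * w ξ := by
  classical
  rcases ht.eq_or_lt with rfl | ht
  · rw [tsum_eq_single ξ]
    · rw [R.transition_zero w hξ, if_pos rfl, mul_one]
    · intro η hη
      by_cases hw : w η = 0
      · simp [hw]
      · rw [R.transition_zero w hw, if_neg hη, mul_zero]
  -- Right-continuity of the single terms need not pass to the infinite sum over `η`, but the
  -- exponential lower bound does.
  refine eq_const_of_ae_of_mul_exp_le (a := w ξ)
    (f := fun t => ∑' η, (σ η : ℝ≥0∞) * w η * R.transition w η ξ t) ?_ ?_ ht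
  · intro s t hst
    rw [← ENNReal.tsum_mul_right]
    refine ENNReal.tsum_le_tsum fun η => ?_
    rw [mul_assoc]
    gcongr
    exact R.transition_mul_le w η ξ hξ hst
  · have hlap : ∀ k : ℕ, ∫⁻ t in Ioi 0, ENNReal.ofReal (Real.exp (-((k + 1) * t)))
        * ∑' η, (σ η : ℝ≥0∞) * w η * R.transition w η ξ t
        = ((k + 1 : ℝ≥0) : ℝ≥0∞)⁻¹ * (σ ξ * w ξ) := by
      intro k
      have h1 := R.lintegral_exp_neg_tsum_transition w σ ξ hξ (k + 1)
      -- The transform at `k + 1` amounts to holding times scaled by `k + 1`, so `W = (k + 1) w`.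
      have h2 := tsum_green_of_invariant R.jumpMatrix (fun ζ => (k + 1) * w ζ)
        (fun x => hrec.green_eq_top R x) σ h ξ (mul_ne_zero (by positivity) hξ)
      have h3 : ∀ η, (σ η : ℝ≥0∞) * (((k + 1) * w η : ℝ≥0) : ℝ≥0∞)
          * green R.jumpMatrix (fun ζ => (1 + (((k + 1) * w ζ : ℝ≥0) : ℝ≥0∞))⁻¹) η ξ
          = ((k + 1 : ℝ≥0) : ℝ≥0∞) * ((σ η : ℝ≥0∞) * w η
            * green R.jumpMatrix (fun ζ => (1 + (((k + 1) * w ζ : ℝ≥0) : ℝ≥0∞))⁻¹) η ξ) := by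
        intro η
        rw [ENNReal.coe_mul]
        ring
      simp only [h3] at h2
      rw [ENNReal.tsum_mul_left] at h2
      rw [← h2, mul_assoc _ _ (w ξ : ℝ≥0∞), ← h1, ← mul_assoc,
        ENNReal.inv_mul_cancel (by simp) ENNReal.coe_ne_top, one_mul]
      push_cast
      rfl
    refine ae_eq_of_lintegral_exp_neg_nat
      (Measurable.tsum fun η => (R.measurable_transition w η ξ).const_mul _) measurable_const
      (fun k => ?_) (fun k => ?_)
    · rw [hlap]
      refine ENNReal.mul_ne_top ?_ (by finiteness)
      simp
    · rw [hlap, lintegral_exp_neg_const]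

/-- The transform at `b = 1` alone makes the Green function symmetric, and the Green function
determines the kernel. -/
lemma jumpMatrix_symm_of_transition (σ : E → ℝ≥0) (hw : ∀ ξ, w ξ ≠ 0) (hσ : ∀ ξ, σ ξ ≠ 0)
    (hinv : ∀ t : ℝ, 0 ≤ t → ∀ ξ,
      ∑' η, (σ η : ℝ≥0∞) * w η * R.transition w η ξ t = σ ξ * w ξ)
    (h : ∀ t : ℝ, 0 ≤ t → ∀ η ξ, (σ η : ℝ≥0∞) * w η * R.transition w η ξ t
      = σ ξ * w ξ * R.transition w ξ η t) (η ξ : E) :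
    (σ η : ℝ≥0∞) * R.jumpMatrix η ξ = σ ξ * R.jumpMatrix ξ η := by
  refine symm_of_green_symm R.jumpMatrix w σ hσ hw
    (R.tsum_green_of_transition_invariant w σ hw hinv) (fun η ξ => ?_) η ξ
  have h1 := R.lintegral_exp_neg_transition w η ξ (hw ξ) 1
  have h2 := R.lintegral_exp_neg_transition w ξ η (hw η) 1
  simp only [one_mul] at h1 h2
  have h3 : (σ η : ℝ≥0∞) * w η * (green R.jumpMatrix (fun ζ => (1 + (w ζ : ℝ≥0∞))⁻¹) η ξ * w ξ)
      = σ ξ * w ξ * (green R.jumpMatrix (fun ζ => (1 + (w ζ : ℝ≥0∞))⁻¹) ξ η * w η) := by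
    rw [← h1, ← h2, ← lintegral_const_mul' _ _ (by finiteness),
      ← lintegral_const_mul' _ _ (by finiteness)]
    refine setLIntegral_congr_fun measurableSet_Ioi fun t ht => ?_
    rw [mul_left_comm, h t (mem_Ioi.1 ht).le, mul_left_comm]
  refine (ENNReal.mul_left_inj (c := (w η : ℝ≥0∞) * w ξ) ?_ (by finiteness)).1 ?_
  · simp [hw]
  · calc _ = (σ η : ℝ≥0∞) * w η
          * (green R.jumpMatrix (fun ζ => (1 + (w ζ : ℝ≥0∞))⁻¹) η ξ * w ξ) := by ring
      _ = _ := by rw [h3]; ring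

/-- If `σ` is reversible for the jump chain, then `σ w` is reversible for the transition
function. -/
lemma transition_symm (hrec : R.ChainRecurrent) (σ : E → ℝ≥0)
    (h : ∀ η ξ, (σ η : ℝ≥0∞) * R.jumpMatrix η ξ = σ ξ * R.jumpMatrix ξ η) {η ξ : E}
    (hη : w η ≠ 0) (hξ : w ξ ≠ 0) {t : ℝ} (ht : 0 ≤ t) :
    (σ η : ℝ≥0∞) * w η * R.transition w η ξ t = σ ξ * w ξ * R.transition w ξ η t := by
  have htop : ∀ η ξ t, R.transition w η ξ t ≠ ∞ := fun η ξ t => by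
    rw [← law_iUnion_occupied]
    finiteness
  refine eq_of_ae_of_tendsto_nhdsGT (f := fun t => (σ η : ℝ≥0∞) * w η * R.transition w η ξ t)
    (g := fun t => σ ξ * w ξ * R.transition w ξ η t) ?_ ht
    (ENNReal.Tendsto.const_mul (R.tendsto_transition w hrec hη ξ ht) (Or.inr (by finiteness)))
    (ENNReal.Tendsto.const_mul (R.tendsto_transition w hrec hξ η ht) (Or.inr (by finiteness)))
  have hlap : ∀ {η ξ : E}, w ξ ≠ 0 → ∀ k : ℕ,
      ∫⁻ t in Ioi 0, ENNReal.ofReal (Real.exp (-((k + 1) * t)))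
        * ((σ η : ℝ≥0∞) * w η * R.transition w η ξ t)
      = w η * w ξ * (σ η
        * green R.jumpMatrix (fun ζ => (1 + (((k + 1) * w ζ : ℝ≥0) : ℝ≥0∞))⁻¹) η ξ) := by
    intro η ξ hξ k
    simp only [mul_left_comm (ENNReal.ofReal _)]
    rw [lintegral_const_mul' _ _ (by finiteness)]
    have h1 := R.lintegral_exp_neg_transition w η ξ hξ (k + 1)
    push_cast at h1 ⊢
    rw [h1]
    ring
  refine ae_eq_of_lintegral_exp_neg_nat ((R.measurable_transition w η ξ).const_mul _)
    ((R.measurable_transition w ξ η).const_mul _) (fun k => ?_) (fun k => ?_)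
  · refine ne_top_of_le_ne_top (b := ∫⁻ t in Ioi (0 : ℝ),
      ENNReal.ofReal (Real.exp (-((k + 1) * t))) * ((σ η : ℝ≥0∞) * w η)) ?_ ?_
    · rw [lintegral_exp_neg_const]
      refine ENNReal.mul_ne_top ?_ (by finiteness)
      simp
    · refine lintegral_mono fun t => ?_
      refine mul_le_mul' le_rfl (mul_le_of_le_one_right' ?_)
      rw [← law_iUnion_occupied]
      exact prob_le_one
  · rw [hlap hξ, hlap hη, green_symm _ _ (fun η => (σ η : ℝ≥0∞)) h]
    ring

end RateMatrix

/-! ### The process and its trace as one chain with two clocks -/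

namespace RateMatrix

variable {E : Type*} (R : RateMatrix E)

/-- The mean holding time `1 / λ(η)`. -/
def holdMean (η : E) : ℝ≥0 := Real.toNNReal (R.holdingRate η)⁻¹

/-- The mean time collected by the additive functional of `h` during one visit to `η`. -/
def traceMean (h : E → ℝ≥0) (η : E) : ℝ≥0 := h η * R.holdMean η

lemma coe_holdMean (η : E) : (R.holdMean η : ℝ) = (R.holdingRate η)⁻¹ :=
  Real.coe_toNNReal _ (inv_nonneg.2 (R.holdingRate_pos η).le)

lemma holdMean_ne_zero (η : E) : R.holdMean η ≠ 0 := by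
  have h : (0 : ℝ) < R.holdMean η := by
    rw [coe_holdMean]
    exact inv_pos.2 (R.holdingRate_pos η)
  exact_mod_cast h.ne'

lemma clock_holdMean (n : ℕ) (ω : (ℕ → E) × (ℕ → ℝ)) :
    clock R.holdMean n ω = ∑ i ∈ Finset.range n, R.holdingTime ω i := by
  unfold clock holdingTime
  refine Finset.sum_congr rfl fun i _ => ?_
  rw [coe_holdMean, div_eq_mul_inv, mul_comm]

lemma coe_traceMean (h : E → ℝ≥0) (η : E) :
    (R.traceMean h η : ℝ) = h η * R.holdMean η := NNReal.coe_mul _ _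

section Path

variable {ω : (ℕ → E) × (ℕ → ℝ)}

lemma process_eq (hω : ∀ n, 0 < ω.2 n) {t : ℝ} {n : ℕ} (hn : clock R.holdMean n ω ≤ t)
    (hn' : t < clock R.holdMean (n + 1) ω) : R.process t ω = ω.1 n := by
  have hmono := clock_mono R.holdMean ω hω
  unfold process jumpIndex
  simp only [← R.clock_holdMean]
  refine congrArg ω.1 (le_antisymm (Nat.sInf_le hn') (le_csInf ⟨n, hn'⟩ fun k hk => ?_))
  by_contra! hlt
  have h1 : clock R.holdMean (k + 1) ω ≤ clock R.holdMean n ω := hmono hlt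
  have h2 : t < clock R.holdMean (k + 1) ω := hk
  linarith

lemma setLIntegral_process (hω : ∀ n, 0 < ω.2 n) (h : E → ℝ≥0)
    {n : ℕ} {r : ℝ} (hr : r ≤ R.holdMean (ω.1 n) * ω.2 n) :
    ∫⁻ s in Ioc (clock R.holdMean n ω) (clock R.holdMean n ω + r), (h (R.process s ω) : ℝ≥0∞)
      = ENNReal.ofReal (h (ω.1 n) * r) := by
  rw [← setLIntegral_congr Ico_ae_eq_Ioc,
    setLIntegral_congr_fun measurableSet_Ico (g := fun _ => (h (ω.1 n) : ℝ≥0∞))]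
  · rw [setLIntegral_const, Real.volume_Ico, add_sub_cancel_left,
      ENNReal.ofReal_mul (NNReal.coe_nonneg _), ENNReal.ofReal_coe_nnreal]
  · intro s hs
    simp only
    rw [R.process_eq hω hs.1 (hs.2.trans_le ?_)]
    rw [clock_succ]
    gcongr

lemma additiveFunctional_add (hω : ∀ n, 0 < ω.2 n) (h : E → ℝ≥0)
    {n : ℕ} {r : ℝ} (hr0 : 0 ≤ r)
    (hr : r ≤ R.holdMean (ω.1 n) * ω.2 n) :
    R.additiveFunctional h (clock R.holdMean n ω + r) ω
      = R.additiveFunctional h (clock R.holdMean n ω) ω + ENNReal.ofReal (h (ω.1 n) * r) := by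
  have h0 : 0 ≤ clock R.holdMean n ω := clock_mono R.holdMean ω hω (Nat.zero_le n)
  unfold additiveFunctional
  rw [← R.setLIntegral_process hω h hr, ← lintegral_union measurableSet_Ioc,
    Ioc_union_Ioc_eq_Ioc h0 (le_add_of_nonneg_right hr0)]
  exact Ioc_disjoint_Ioc_of_le le_rfl

lemma additiveFunctional_clock (hω : ∀ n, 0 < ω.2 n) (h : E → ℝ≥0)
    (n : ℕ) :
    R.additiveFunctional h (clock R.holdMean n ω) ω
      = ENNReal.ofReal (clock (R.traceMean h) n ω) := by
  induction n with
  | zero => simp [clock_zero, additiveFunctional]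
  | succ n ih =>
    have h0 : 0 ≤ clock (R.traceMean h) n ω := clock_mono _ ω hω (Nat.zero_le n)
    have h1 : 0 ≤ R.holdMean (ω.1 n) * ω.2 n := mul_nonneg (NNReal.coe_nonneg _) (hω n).le
    rw [clock_succ, R.additiveFunctional_add hω h h1 le_rfl, ih, clock_succ,
      ← ENNReal.ofReal_add h0 (mul_nonneg (NNReal.coe_nonneg _) h1)]
    congr 2
    rw [coe_traceMean]
    ring

/-- A nonempty interval between consecutive values of the trace clock forces `h (ω.1 n) > 0`. The
additive functional then grows at that rate throughout the `n`-th sojourn, so its inverse at `t`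
lies inside this sojourn. -/
lemma trace_eq (hω : ∀ n, 0 < ω.2 n) (h : E → ℝ≥0)
    {t : ℝ} {n : ℕ} (hn : clock (R.traceMean h) n ω ≤ t)
    (hn' : t < clock (R.traceMean h) (n + 1) ω) : R.trace h t ω = ω.1 n := by
  have hA0 : 0 ≤ clock (R.traceMean h) n ω := clock_mono _ ω hω (Nat.zero_le n)
  have hS0 : 0 ≤ clock R.holdMean n ω := clock_mono _ ω hω (Nat.zero_le n)
  have hmean : (0 : ℝ) < R.holdMean (ω.1 n) := by
    have := R.holdMean_ne_zero (ω.1 n)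
    positivity
  have hhpos : (0 : ℝ) < h (ω.1 n) := by
    rw [clock_succ] at hn'
    by_contra! hcon
    have h1 : (h (ω.1 n) : ℝ) = 0 := le_antisymm hcon (NNReal.coe_nonneg _)
    rw [coe_traceMean, h1] at hn'
    linarith
  set r := (t - clock (R.traceMean h) n ω) / h (ω.1 n) with hr
  have hr0 : 0 ≤ r := div_nonneg (sub_nonneg.2 hn) hhpos.le
  have hr1 : r < R.holdMean (ω.1 n) * ω.2 n := by
    rw [hr, div_lt_iff₀ hhpos]
    rw [clock_succ, coe_traceMean] at hn'
    linarith
  have hval : ∀ u, 0 ≤ u → u ≤ R.holdMean (ω.1 n) * ω.2 n →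
      R.additiveFunctional h (clock R.holdMean n ω + u) ω
        = ENNReal.ofReal (clock (R.traceMean h) n ω + h (ω.1 n) * u) := by
    intro u hu0 hu
    rw [R.additiveFunctional_add hω h hu0 hu, R.additiveFunctional_clock hω h,
      ENNReal.ofReal_add hA0 (mul_nonneg hhpos.le hu0)]
  have hsup : R.inverseFunctional h t ω = clock R.holdMean n ω + r := by
    refine IsGreatest.csSup_eq ⟨⟨by positivity, ?_⟩, fun s hs => ?_⟩
    · rw [hval r hr0 hr1.le, hr, mul_div_cancel₀ _ hhpos.ne', add_sub_cancel]
    · by_contra! hlt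
      -- A candidate `s` may lie beyond the sojourn; capping at its end keeps `hval` applicable, and
      -- monotonicity of the functional does the rest.
      set u := min (s - clock R.holdMean n ω) (R.holdMean (ω.1 n) * ω.2 n) with hu
      have hru : r < u := lt_min (by linarith) hr1
      have h1 : R.additiveFunctional h (clock R.holdMean n ω + u) ω ≤ ENNReal.ofReal t := by
        refine le_trans ?_ hs.2
        unfold additiveFunctional
        refine lintegral_mono_set (Ioc_subset_Ioc_right ?_)
        have := min_le_left (s - clock R.holdMean n ω) (R.holdMean (ω.1 n) * ω.2 n)
        linarith
      rw [hval u (hr0.trans hru.le) (min_le_right _ _),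
        ENNReal.ofReal_le_ofReal_iff (hA0.trans hn)] at h1
      rw [hr, div_lt_iff₀ hhpos] at hru
      linarith
  unfold trace
  rw [hsup]
  refine R.process_eq hω (by linarith) ?_
  rw [clock_succ]
  linarith

end Path

end RateMatrix

/-! ### Excursions from `η` through `ξ` and back -/

section TwoStage

variable {E : Type*}

/-- The path `y` has not visited `ξ` between times `1` and `n`. -/
def Unvisited (ξ : E) (y : ℕ → E) (n : ℕ) : Prop := ∀ k, 1 ≤ k → k ≤ n → y k ≠ ξ

/-- The path `y` has not visited `η` after a visit to `ξ` between times `1` and `n`. -/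
def Unreturned (ξ η : E) (y : ℕ → E) (n : ℕ) : Prop :=
  ∀ k j, 1 ≤ k → k < j → j ≤ n → y k = ξ → y j ≠ η

lemma Unvisited.unreturned {ξ η : E} {y : ℕ → E} {n : ℕ} (h : Unvisited ξ y n) :
    Unreturned ξ η y n :=
  fun k _ hk hkj hj hy _ => h k hk (hkj.le.trans hj) hy

lemma unvisited_succ {ξ : E} {y : ℕ → E} {n : ℕ} :
    Unvisited ξ y (n + 1) ↔ Unvisited ξ y n ∧ y (n + 1) ≠ ξ := by
  refine ⟨fun h => ⟨fun k hk hkn => h k hk (by omega), h (n + 1) (by omega) le_rfl⟩, ?_⟩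
  rintro ⟨h1, h2⟩ k hk hkn
  rcases Nat.lt_or_ge n k with h | h
  · rwa [show k = n + 1 by omega]
  · exact h1 k hk h

lemma unreturned_succ {ξ η : E} {y : ℕ → E} {n : ℕ} :
    Unreturned ξ η y (n + 1) ↔
      Unreturned ξ η y n ∧ (y (n + 1) ≠ η ∨ Unvisited ξ y n) := by
  constructor
  · intro h
    refine ⟨fun k j hk hkj hj => h k j hk hkj (by omega), ?_⟩
    by_contra! hcon
    obtain ⟨h1, h2⟩ := hcon
    refine h2 fun k hk hkn hy => ?_
    exact h k (n + 1) hk (by omega) le_rfl hy h1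
  · rintro ⟨h1, h2⟩ k j hk hkj hj hy
    rcases Nat.lt_or_ge n j with h | h
    · rw [show j = n + 1 by omega]
      rcases h2 with h2 | h2
      · exact h2
      · exact absurd hy (h2 k hk (by omega))
    · exact h1 k j hk hkj h hy

lemma unvisited_congr {ξ : E} {y y' : ℕ → E} {n : ℕ} (h : ∀ k ≤ n, y k = y' k) :
    Unvisited ξ y n ↔ Unvisited ξ y' n := by
  unfold Unvisited
  refine forall_congr' fun k => forall_congr' fun _ => forall_congr' fun hk => ?_
  rw [h k hk]

lemma unreturned_congr {ξ η : E} {y y' : ℕ → E} {n : ℕ} (h : ∀ k ≤ n, y k = y' k) :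
    Unreturned ξ η y n ↔ Unreturned ξ η y' n := by
  unfold Unreturned
  refine forall_congr' fun k => forall_congr' fun j => forall_congr' fun _ =>
    forall_congr' fun hkj => forall_congr' fun hj => ?_
  rw [h k (hkj.le.trans hj), h j hj]

end TwoStage

namespace RateMatrix

variable {E : Type*} (R : RateMatrix E)

lemma tsum_jumpMatrix (η : E) : ∑' ξ, R.jumpMatrix η ξ = 1 := (R.jumpPMF η).tsum_coe

variable [Countable E] [MeasurableSpace E] [DiscreteMeasurableSpace E]

/-- The Markov property for functionals of the path up to time `n`. -/
lemma lintegral_chainLaw_succ_of_congr (η : E) (n : ℕ) (P : (ℕ → E) → Prop)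
    [DecidablePred P] (hP : ∀ y y' : ℕ → E, (∀ k ≤ n, y k = y' k) → (P y ↔ P y'))
    (g : E → ℝ≥0∞) :
    ∫⁻ y, (if P y then g (y (n + 1)) else 0) ∂(R.chainLaw η)
      = ∫⁻ y, (if P y then ∑' ξ, R.jumpMatrix (y n) ξ * g ξ else 0) ∂(R.chainLaw η) := by
  classical
  -- The filler beyond time `n` is arbitrary, since `P` sees only the path up to `n`.
  set ext : ((i : Finset.Iic n) → E) → ℕ → E := fun x k =>
    if hk : k ≤ n then x ⟨k, Finset.mem_Iic.2 hk⟩ else η with hext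
  have h := R.lintegral_chainLaw_succ η n (fun x => if P (ext x) then 1 else 0) .of_discrete g
  have hPe : ∀ y : ℕ → E, P (ext fun i => y i) ↔ P y := fun y =>
    hP _ _ fun k hk => by simp [hext, hk]
  simpa only [hPe, ite_mul, one_mul, zero_mul] using h

lemma measurableSet_unvisited (ξ : E) (n : ℕ) : MeasurableSet {y : ℕ → E | Unvisited ξ y n} := by
  have : {y : ℕ → E | Unvisited ξ y n} = ⋂ k, ⋂ (_ : 1 ≤ k), ⋂ (_ : k ≤ n), {y | y k = ξ}ᶜ := by
    ext y
    simp [Unvisited]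
  rw [this]
  exact .iInter fun k => .iInter fun _ => .iInter fun _ => (measurableSet_chain_eq k ξ).compl

lemma measurableSet_unreturned (ξ η : E) (n : ℕ) :
    MeasurableSet {y : ℕ → E | Unreturned ξ η y n} := by
  have : {y : ℕ → E | Unreturned ξ η y n}
      = ⋂ k, ⋂ j, ⋂ (_ : 1 ≤ k), ⋂ (_ : k < j), ⋂ (_ : j ≤ n),
        ({y | y k = ξ} ∩ {y | y j = η})ᶜ := by
    ext y
    simp only [Unreturned, mem_ofPred_eq, mem_iInter, mem_compl_iff, mem_inter_iff, not_and, ne_eq]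
  rw [this]
  exact .iInter fun k => .iInter fun j => .iInter fun _ => .iInter fun _ => .iInter fun _ =>
    ((measurableSet_chain_eq k ξ).inter (measurableSet_chain_eq j η)).compl

open Classical in
/-- The expected weight collected before the first visit to `η` after a visit to `ξ`. -/
lemma tsum_lintegral_unreturned_le (w : E → ℝ≥0∞) (ξ η : E) :
    ∑' n, ∫⁻ y, (if Unreturned ξ η y n then w (y n) else 0) ∂(R.chainLaw η)
      ≤ tabooPotential R.jumpMatrix w ξ η + tabooPotential R.jumpMatrix w η ξ := by
  set V₁ := tabooPotential R.jumpMatrix w ξ with hV₁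
  set V₂ := tabooPotential R.jumpMatrix w η with hV₂
  -- A bound for the weight still to be collected: `V₁` until `ξ` is hit plus a full second stage,
  -- then `V₂` until `η`, then nothing. Below, `g₁` and `g₂` give its next value in the two stages.
  set v : ℕ → (ℕ → E) → ℝ≥0∞ := fun n y =>
    if Unvisited ξ y n then V₁ (y n) + V₂ ξ
    else if Unreturned ξ η y n then V₂ (y n) else 0 with hv
  set g₁ : E → ℝ≥0∞ := fun ζ => if ζ = ξ then V₂ ξ else V₁ ζ + V₂ ξ with hg₁
  set g₂ : E → ℝ≥0∞ := fun ζ => if ζ = η then 0 else V₂ ζ with hg₂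
  have hsum₁ : ∀ x, w x + ∑' ζ, R.jumpMatrix x ζ * g₁ ζ = V₁ x + V₂ ξ := by
    intro x
    have : ∀ ζ, R.jumpMatrix x ζ * g₁ ζ
        = tabooKernel R.jumpMatrix ξ x ζ * V₁ ζ + R.jumpMatrix x ζ * V₂ ξ := by
      intro ζ
      simp only [hg₁, tabooKernel]
      split_ifs <;> ring
    simp only [this]
    rw [ENNReal.tsum_add, ENNReal.tsum_mul_right, R.tsum_jumpMatrix, one_mul, ← add_assoc, hV₁,
      ← tabooPotential_eq]
  have hsum₂ : ∀ x, w x + ∑' ζ, R.jumpMatrix x ζ * g₂ ζ = V₂ x := by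
    intro x
    have : ∀ ζ, R.jumpMatrix x ζ * g₂ ζ = tabooKernel R.jumpMatrix η x ζ * V₂ ζ := by
      intro ζ
      simp only [hg₂, tabooKernel]
      split_ifs <;> simp
    simp only [this]
    rw [hV₂, ← tabooPotential_eq]
  have hwm : ∀ (n : ℕ) (g : E → ℝ≥0∞), Measurable fun y : ℕ → E => g (y n) := fun n g =>
    (Measurable.of_discrete (f := g)).comp (measurable_pi_apply n)
  have hm₁ : ∀ (n : ℕ) (g : (ℕ → E) → ℝ≥0∞), Measurable g →
      Measurable fun y : ℕ → E => if Unvisited ξ y n then g y else 0 := fun n g hg =>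
    Measurable.ite (measurableSet_unvisited ξ n) hg measurable_const
  have hset₂ : ∀ n, MeasurableSet {y : ℕ → E | ¬ Unvisited ξ y n ∧ Unreturned ξ η y n} := fun n =>
    (measurableSet_unvisited ξ n).compl.inter (measurableSet_unreturned ξ η n)
  have hm₂ : ∀ n, Measurable fun y : ℕ → E => if Unreturned ξ η y n then w (y n) else 0 := fun n =>
    Measurable.ite (measurableSet_unreturned ξ η n) (hwm n w) measurable_const
  have hstep : ∀ n, ∫⁻ y, (if Unreturned ξ η y n then w (y n) else 0) ∂(R.chainLaw η)
      + ∫⁻ y, v (n + 1) y ∂(R.chainLaw η) ≤ ∫⁻ y, v n y ∂(R.chainLaw η) := by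
    intro n
    have hdec : ∀ y : ℕ → E, v (n + 1) y ≤ (if Unvisited ξ y n then g₁ (y (n + 1)) else 0)
        + (if ¬ Unvisited ξ y n ∧ Unreturned ξ η y n then g₂ (y (n + 1)) else 0) := by
      intro y
      simp only [hv, hg₁, hg₂, unvisited_succ, unreturned_succ]
      by_cases h1 : Unvisited ξ y n
      · have h3 : Unreturned ξ η y n := h1.unreturned
        by_cases h2 : y (n + 1) = ξ <;> simp [h1, h2, h3]
      · by_cases h3 : Unreturned ξ η y n <;> by_cases h4 : y (n + 1) = η <;> simp [h1, h3, h4]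
    have hle : ∫⁻ y, v (n + 1) y ∂(R.chainLaw η)
        ≤ ∫⁻ y, (if Unvisited ξ y n then ∑' ζ, R.jumpMatrix (y n) ζ * g₁ ζ else 0)
          + (if ¬ Unvisited ξ y n ∧ Unreturned ξ η y n
            then ∑' ζ, R.jumpMatrix (y n) ζ * g₂ ζ else 0) ∂(R.chainLaw η) := by
      refine (lintegral_mono hdec).trans ?_
      rw [lintegral_add_left (hm₁ n _ (hwm (n + 1) g₁)),
        lintegral_add_left (hm₁ n _ (hwm n fun x => ∑' ζ, R.jumpMatrix x ζ * g₁ ζ)),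
        R.lintegral_chainLaw_succ_of_congr η n (fun y => Unvisited ξ y n)
          (fun y y' h => unvisited_congr h) g₁,
        R.lintegral_chainLaw_succ_of_congr η n
          (fun y => ¬ Unvisited ξ y n ∧ Unreturned ξ η y n)
          (fun y y' h => by rw [unvisited_congr h, unreturned_congr h]) g₂]
    refine (add_le_add_right hle _).trans ?_
    rw [← lintegral_add_left (hm₂ n)]
    refine lintegral_mono fun y => ?_
    simp only [hv]
    by_cases h1 : Unvisited ξ y n
    · simp only [h1, h1.unreturned, if_true, not_true_eq_false, false_and, if_false, add_zero]
      exact (hsum₁ (y n)).le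
    · by_cases h2 : Unreturned ξ η y n
      · simp only [h1, h2, if_true, if_false, not_false_eq_true, true_and, zero_add]
        exact (hsum₂ (y n)).le
      · simp [h1, h2]
  have hpart : ∀ N, ∑ n ∈ Finset.range N,
      ∫⁻ y, (if Unreturned ξ η y n then w (y n) else 0) ∂(R.chainLaw η)
      + ∫⁻ y, v N y ∂(R.chainLaw η) ≤ ∫⁻ y, v 0 y ∂(R.chainLaw η) := by
    intro N
    induction N with
    | zero => simp
    | succ N ih =>
      rw [Finset.sum_range_succ, add_assoc]
      exact (add_le_add_right (hstep N) _).trans ih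
  have hzero : ∫⁻ y, v 0 y ∂(R.chainLaw η) = V₁ η + V₂ ξ := by
    have : ∀ᵐ y ∂(R.chainLaw η), v 0 y = V₁ η + V₂ ξ := by
      filter_upwards [R.ae_chainLaw_zero η] with y hy
      have h0 : Unvisited ξ y 0 := fun k hk hk0 => by omega
      simp only [hv, h0, if_true, hy]
    rw [lintegral_congr_ae this]
    simp
  rw [ENNReal.tsum_eq_iSup_nat, ← hzero]
  exact iSup_le fun N => le_self_add.trans (hpart N)

end RateMatrix

/-! ### Return times of the trace and the measure `λ μ` -/

namespace RateMatrix

variable {E : Type*} (R : RateMatrix E)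

-- The chain may come back to `η` through states where `h` vanishes, without the trace ever leaving
-- `η`. Passing through a fixed `ξ` with positive holding time guarantees a genuine departure, and
-- the clock at the next visit to `η` bounds the return time.
open Classical in
lemma returnTime_trace_le (h : E → ℝ≥0) {η ξ : E} (hne : ξ ≠ η) (hη : R.traceMean h η ≠ 0)
    (hξ : R.traceMean h ξ ≠ 0) {ω : (ℕ → E) × (ℕ → ℝ)} (hω : ∀ n, 0 < ω.2 n) (h0 : ω.1 0 = η)
    (hclock : ∀ t, ∃ n, t < clock (R.traceMean h) n ω) :
    returnTime (R.trace h) η ω ≤ ∑' n, (if Unreturned ξ η ω.1 n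
      then (R.traceMean h (ω.1 n) : ℝ≥0∞) else 0) * ENNReal.ofReal (ω.2 n) := by
  set w := R.traceMean h with hw
  have hmono := clock_mono w ω hω
  have hpartial : ∀ m, (∀ n < m, Unreturned ξ η ω.1 n) →
      ENNReal.ofReal (clock w m ω) ≤ ∑' n, (if Unreturned ξ η ω.1 n
        then (w (ω.1 n) : ℝ≥0∞) else 0) * ENNReal.ofReal (ω.2 n) := by
    intro m hm
    refine le_trans (le_of_eq ?_) (ENNReal.sum_le_tsum (Finset.range m))
    unfold clock
    rw [ENNReal.ofReal_sum_of_nonneg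
      fun i _ => mul_nonneg (NNReal.coe_nonneg _) (hω i).le]
    refine Finset.sum_congr rfl fun i hi => ?_
    rw [if_pos (hm i (Finset.mem_range.1 hi)), ENNReal.ofReal_mul (NNReal.coe_nonneg _),
      ENNReal.ofReal_coe_nnreal]
  have hjump : ∀ n, w (ω.1 n) ≠ 0 → clock w n ω < clock w (n + 1) ω := by
    intro n hn
    rw [clock_succ]
    have := hω n
    have h1 : (0 : ℝ) < w (ω.1 n) := by positivity
    nlinarith [mul_pos h1 this]
  -- If the two-stage excursion never ends, the right-hand side dominates a divergent clock and is
  -- infinite.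
  by_cases hall : ∀ n, Unreturned ξ η ω.1 n
  · refine le_trans le_top (le_of_eq (Eq.symm (ENNReal.eq_top_of_forall_nnreal_le fun r => ?_)))
    obtain ⟨n, hn⟩ := hclock r
    refine le_trans ?_ (hpartial n fun m _ => hall m)
    rw [← ENNReal.ofReal_coe_nnreal]
    exact ENNReal.ofReal_le_ofReal hn.le
  · have hex : ∃ n, ¬ Unreturned ξ η ω.1 n := not_forall.1 hall
    set m := Nat.find hex with hm
    have hbefore : ∀ n < m, Unreturned ξ η ω.1 n := fun n hn => not_not.1 (Nat.find_min hex hn)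
    have hspec : ¬ Unreturned ξ η ω.1 m := Nat.find_spec hex
    unfold Unreturned at hspec
    push Not at hspec
    obtain ⟨k, j, hk, hkj, hjm, hyk, hyj⟩ := hspec
    -- At the first failure `m`, the visit to `η` must occur at time `m` itself, so the weights
    -- summed before it make up `clock w m ω`.
    have hj : j = m := by
      by_contra hne'
      exact hbefore j (lt_of_le_of_ne hjm hne') k j hk hkj le_rfl hyk hyj
    subst hj
    refine le_trans ?_ (hpartial _ hbefore)
    have h01 : 0 < clock w 1 ω := by
      have := hjump 0 (by rwa [h0])
      rwa [clock_zero] at this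
    have hkpos : 0 < clock w k ω := h01.trans_le (hmono hk)
    have hkm : clock w k ω < clock w m ω :=
      (hjump k (by rwa [hyk])).trans_le (hmono hkj)
    have hX : ∀ n, w (ω.1 n) ≠ 0 → R.trace h (clock w n ω) ω = ω.1 n := fun n hn =>
      R.trace_eq hω h le_rfl (hjump n hn)
    unfold returnTime
    refine iInf₂_le (clock w m ω) ⟨hkpos.trans hkm, ?_, clock w k ω, hkpos, hkm, ?_⟩
    · rw [hX m (by rwa [hyj]), hyj]
    · have hX0 : R.trace h 0 ω = ω.1 0 :=
        R.trace_eq hω h (clock_zero w ω).le (by simpa using h01)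
      rw [hX k (by rwa [hyk]), hX0, hyk, h0]
      exact hne

/-- The invariant measure of the jump chain with density `λ` with respect to `μ`. -/
def jumpMeasure (μ : E → ℝ≥0) (η : E) : ℝ≥0 := μ η / R.holdMean η

lemma jumpMeasure_mul_holdMean (μ : E → ℝ≥0) (η : E) :
    (R.jumpMeasure μ η : ℝ≥0∞) * R.holdMean η = μ η := by
  rw [← ENNReal.coe_mul, jumpMeasure, div_mul_cancel₀ _ (R.holdMean_ne_zero η)]

lemma jumpMeasure_mul_traceMean (μ h : E → ℝ≥0) (η : E) :
    (R.jumpMeasure μ η : ℝ≥0∞) * R.traceMean h η = (h η * μ η : ℝ≥0) := by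
  rw [← ENNReal.coe_mul, traceMean, mul_left_comm, jumpMeasure,
    div_mul_cancel₀ _ (R.holdMean_ne_zero η)]

variable [Countable E] [MeasurableSpace E] [DiscreteMeasurableSpace E]

/-- The exponential factors are independent of the chain and have mean one, so only expected path
weights of the chain remain. -/
lemma lintegral_returnTime_trace_le (hrec : R.ChainRecurrent) (h : E → ℝ≥0) {η ξ : E}
    (hne : ξ ≠ η) (hη : R.traceMean h η ≠ 0) (hξ : R.traceMean h ξ ≠ 0) :
    ∫⁻ ω, returnTime (R.trace h) η ω ∂(R.law η)
      ≤ tabooPotential R.jumpMatrix (fun ζ => R.traceMean h ζ) ξ η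
        + tabooPotential R.jumpMatrix (fun ζ => R.traceMean h ζ) η ξ := by
  classical
  have hf : ∀ n, Measurable fun y : ℕ → E =>
      if Unreturned ξ η y n then (R.traceMean h (y n) : ℝ≥0∞) else 0 := fun n =>
    Measurable.ite (measurableSet_unreturned ξ η n)
      ((Measurable.of_discrete (f := fun ζ => (R.traceMean h ζ : ℝ≥0∞))).comp
        (measurable_pi_apply n)) measurable_const
  have hg : ∀ n, Measurable fun e : ℕ → ℝ => ENNReal.ofReal (e n) := fun n => by fun_prop
  have hmean : ∀ n, ∫⁻ e, ENNReal.ofReal (e n) ∂expSeq = 1 := fun n => by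
    rw [← lintegral_expMeasure_one_id, ← expSeq_map_eval n,
      lintegral_map ENNReal.measurable_ofReal (measurable_pi_apply n)]
  calc ∫⁻ ω, returnTime (R.trace h) η ω ∂(R.law η)
      ≤ ∫⁻ ω, ∑' n, (if Unreturned ξ η ω.1 n
          then (R.traceMean h (ω.1 n) : ℝ≥0∞) else 0) * ENNReal.ofReal (ω.2 n) ∂(R.law η) := by
        refine lintegral_mono_ae ?_
        filter_upwards [R.ae_law_pos η, R.ae_law_zero η,
          hrec.ae_exists_lt_clock R (R.traceMean h) hη] with ω h1 h2 h3
        exact R.returnTime_trace_le h hne hη hξ h1 h2 h3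
    _ = ∑' n, ∫⁻ y, (if Unreturned ξ η y n then (R.traceMean h (y n) : ℝ≥0∞) else 0)
          ∂(R.chainLaw η) := by
        rw [lintegral_tsum]
        · refine tsum_congr fun n => ?_
          refine (lintegral_prod_mul (hf n).aemeasurable (hg n).aemeasurable).trans ?_
          change _ * ∫⁻ e, ENNReal.ofReal (e n) ∂expSeq = _
          rw [hmean, mul_one]
        · exact fun n => (((hf n).comp measurable_fst).mul
            ((hg n).comp measurable_snd)).aemeasurable
    _ ≤ _ := R.tsum_lintegral_unreturned_le (fun ζ => R.traceMean h ζ) ξ η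

lemma ae_trace_eq (η : E) (h : E → ℝ≥0) :
    ∀ᵐ ω ∂(R.law η), ∀ t n, clock (R.traceMean h) n ω ≤ t →
      t < clock (R.traceMean h) (n + 1) ω → R.trace h t ω = ω.1 n := by
  filter_upwards [R.ae_law_pos η] with ω hω t n hn hn'
  exact R.trace_eq hω h hn hn'

lemma law_process_eq (hrec : R.ChainRecurrent) (η ξ : E) {t : ℝ} (ht : 0 ≤ t) :
    R.law η {ω | R.process t ω = ξ} = R.transition R.holdMean η ξ t := by
  refine R.law_eq_transition R.holdMean hrec (R.holdMean_ne_zero η) ht _ ?_ ξ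
  filter_upwards [R.ae_law_pos η] with ω hω n hn hn'
  exact R.process_eq hω hn hn'

lemma law_trace_eq (hrec : R.ChainRecurrent) (h : E → ℝ≥0) {η : E} (hη : R.traceMean h η ≠ 0)
    (ξ : E) {t : ℝ} (ht : 0 ≤ t) :
    R.law η {ω | R.trace h t ω = ξ} = R.transition (R.traceMean h) η ξ t := by
  refine R.law_eq_transition (R.traceMean h) hrec hη ht _ ?_ ξ
  filter_upwards [R.ae_trace_eq η h] with ω hω n hn hn'
  exact hω t n hn hn'

lemma ae_not_bddAbove_trace (hrec : R.ChainRecurrent) (h : E → ℝ≥0) {η : E}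
    (hη : R.traceMean h η ≠ 0) :
    ∀ᵐ ω ∂(R.law η), ¬ BddAbove {t : ℝ | 0 ≤ t ∧ R.trace h t ω = η} := by
  filter_upwards [R.ae_law_pos η, hrec.ae_exists_lt_clock R (R.traceMean h) hη,
    R.ae_law_fst (hrec η)] with ω h1 h2 h3
  rintro ⟨M, hM⟩
  obtain ⟨N, hN⟩ := h2 M
  obtain ⟨n, hn, hy⟩ := frequently_atTop.1 h3 N
  have hmono := clock_mono (R.traceMean h) ω h1
  have h4 : clock (R.traceMean h) N ω ≤ clock (R.traceMean h) n ω := hmono hn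
  have h5 : 0 ≤ clock (R.traceMean h) n ω := hmono (Nat.zero_le n)
  refine absurd (hM ⟨h5, ?_⟩) (hN.trans_le h4).not_ge
  rw [R.trace_eq h1 h le_rfl, hy]
  rw [clock_succ, hy]
  have := h1 n
  exact lt_add_of_pos_right _ (by positivity)

lemma ae_trace_mem (hrec : R.ChainRecurrent) (h : E → ℝ≥0) {η : E} (hη : R.traceMean h η ≠ 0) :
    ∀ᵐ ω ∂(R.law η), ∀ t : ℝ, 0 ≤ t → h (R.trace h t ω) ≠ 0 := by
  filter_upwards [R.ae_law_pos η, hrec.ae_exists_lt_clock R (R.traceMean h) hη] with ω h1 h2 t ht h0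
  obtain ⟨n, hn, hn'⟩ := exists_clock_le_lt (R.traceMean h) ω ht (h2 t)
  rw [R.trace_eq h1 h hn hn'] at h0
  rw [clock_succ, coe_traceMean, h0] at hn'
  simp at hn'
  linarith

lemma transition_holdMean_invariant (hrec : R.ChainRecurrent) (μ : E → ℝ≥0)
    (hμ : IsInvariantMeasure R.law R.process univ fun η => μ η) (t : ℝ) (ht : 0 ≤ t) (ξ : E) :
    ∑' η, (R.jumpMeasure μ η : ℝ≥0∞) * R.holdMean η * R.transition R.holdMean η ξ t
      = R.jumpMeasure μ ξ * R.holdMean ξ := by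
  simp only [jumpMeasure_mul_holdMean, ← R.law_process_eq hrec _ _ ht]
  have h := hμ.2 t ht ⟨ξ, mem_univ ξ⟩
  rw [tsum_univ fun η => (μ η : ℝ≥0∞) * R.law η {ω | R.process t ω = ξ}] at h
  exact h

lemma jumpMeasure_invariant (hrec : R.ChainRecurrent) (μ : E → ℝ≥0)
    (hμ : IsInvariantMeasure R.law R.process univ fun η => μ η) (ξ : E) :
    ∑' ζ, (R.jumpMeasure μ ζ : ℝ≥0∞) * R.jumpMatrix ζ ξ = R.jumpMeasure μ ξ :=
  invariant_of_tsum_green R.jumpMatrix R.holdMean (R.jumpMeasure μ)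
    (R.tsum_green_of_transition_invariant R.holdMean (R.jumpMeasure μ) R.holdMean_ne_zero
      (R.transition_holdMean_invariant hrec μ hμ)) ξ

/-- An invariant measure of an irreducible chain charges every state. -/
lemma ne_zero_of_invariant (hirr : R.ChainIrreducible) (σ : E → ℝ≥0∞)
    (h : ∀ ξ, ∑' ζ, σ ζ * R.jumpMatrix ζ ξ = σ ξ) {η : E} (hη : σ η ≠ 0) (ξ : E) : σ ξ ≠ 0 := by
  have key : ∀ n ξ, killedPower R.jumpMatrix 1 n η ξ ≠ 0 → σ ξ ≠ 0 := by
    classical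
    intro n
    induction n with
    | zero =>
      intro ξ hξ
      rw [killedPower_zero] at hξ
      have : η = ξ := by by_contra hh; simp [hh] at hξ
      rwa [← this]
    | succ n ih =>
      intro ξ hξ
      rw [killedPower_succ, Pi.one_apply, mul_one, ne_eq, ENNReal.tsum_eq_zero, not_forall] at hξ
      obtain ⟨ζ, hζ⟩ := hξ
      rw [← h ξ, ne_eq, ENNReal.tsum_eq_zero, not_forall]
      exact ⟨ζ, mul_ne_zero (ih ζ (left_ne_zero_of_mul hζ)) (right_ne_zero_of_mul hζ)⟩
  obtain ⟨n, hn⟩ := hirr.exists_killedPower_ne_zero R η ξ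
  exact key n ξ hn

lemma jumpMeasure_ne_zero (hirr : R.ChainIrreducible) (hrec : R.ChainRecurrent) (μ : E → ℝ≥0)
    (hμ : IsInvariantMeasure R.law R.process univ fun η => μ η) (ξ : E) :
    R.jumpMeasure μ ξ ≠ 0 := by
  obtain ⟨η, hη⟩ := Function.ne_iff.1 hμ.1
  have h : (R.jumpMeasure μ η : ℝ≥0∞) ≠ 0 := by
    simpa [jumpMeasure, R.holdMean_ne_zero] using hη
  simpa using R.ne_zero_of_invariant hirr (fun η => R.jumpMeasure μ η)
    (R.jumpMeasure_invariant hrec μ hμ) h ξ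

lemma tabooPotential_traceMean_ne_top (hirr : R.ChainIrreducible) (hrec : R.ChainRecurrent)
    (μ : E → ℝ≥0) (hμ : IsInvariantMeasure R.law R.process univ fun η => μ η) (h : E → ℝ≥0)
    (hsum : Summable fun η => h η * μ η) (η ξ : E) :
    tabooPotential R.jumpMatrix (fun ζ => R.traceMean h ζ) η ξ ≠ ∞ := by
  obtain ⟨n, hn⟩ := hirr.exists_killedPower_ne_zero R η ξ
  refine tabooPotential_ne_top _ _ η (fun htop => ?_) n ξ hn
  have h1 := mul_tabooPotential_self_le R.jumpMatrix (fun ζ => R.traceMean h ζ) η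
    (fun ζ => (R.jumpMeasure μ ζ : ℝ≥0∞)) (R.jumpMeasure_invariant hrec μ hμ)
  simp only [jumpMeasure_mul_traceMean] at h1
  rw [htop, ENNReal.mul_top (by simpa using R.jumpMeasure_ne_zero hirr hrec μ hμ η),
    top_le_iff] at h1
  exact ENNReal.tsum_coe_ne_top_iff_summable.2 hsum h1

end RateMatrix

end

/-! ### The theorem -/

theorem proposition6p3 {E : Type*} [Countable E] [MeasurableSpace E] [DiscreteMeasurableSpace E]
    (R : RateMatrix E) (hirr : R.ChainIrreducible) (hrec : R.ChainRecurrent)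
    (h : E → ℝ≥0) (F : Set E) (hF : F = {η | 0 < h η}) (hne : F.Nonempty)
    (μ : E → ℝ≥0) (hμ : IsInvariantMeasure R.law R.process univ fun η => μ η) :
    IsInvariantMeasure R.law (R.trace h) F (fun η => h η * μ η) ∧
    (Summable (fun η => h η * μ η) → IsPositiveRecurrent R.law (R.trace h) F) ∧
    (IsReversibleMeasure R.law R.process univ (fun η => μ η) →
      IsReversibleMeasure R.law (R.trace h) F fun η => h η * μ η) := by
  have hmem : ∀ {η}, η ∈ F ↔ h η ≠ 0 := fun {η} => by
    rw [hF, mem_ofPred_eq, pos_iff_ne_zero]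
  have hw : ∀ {η}, η ∈ F → R.traceMean h η ≠ 0 := fun {η} hη =>
    mul_ne_zero (hmem.1 hη) (R.holdMean_ne_zero η)
  have hσ := R.jumpMeasure_invariant hrec μ hμ
  have hσ0 := R.jumpMeasure_ne_zero hirr hrec μ hμ
  have hnz : (fun η : F => h η * μ η) ≠ 0 := by
    obtain ⟨η, hη⟩ := hne
    refine Function.ne_iff.2 ⟨⟨η, hη⟩, mul_ne_zero (hmem.1 hη) fun h0 => hσ0 η ?_⟩
    rw [RateMatrix.jumpMeasure, h0, zero_div]
  refine ⟨⟨hnz, fun t ht ξ => ?_⟩, fun hsum η hη => ⟨R.ae_not_bddAbove_trace hrec h (hw hη), ?_⟩,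
    fun hrev => ⟨hnz, fun t ht η ξ => ?_⟩⟩
  · have h1 := R.transition_invariant (R.traceMean h) hrec (R.jumpMeasure μ) hσ ξ (hw ξ.2) ht
    simp only [R.jumpMeasure_mul_traceMean] at h1
    -- States outside `F` have zero mass `h μ`, so the sum over `E` reduces to one over `F`, where
    -- the trace law is known.
    rw [← h1, ← tsum_subtype_eq_of_support_subset (s := F)]
    · refine tsum_congr fun η => ?_
      rw [R.law_trace_eq hrec h (hw η.2) _ ht]
    · intro η hη
      rw [hmem]
      rintro h0
      simp [h0] at hη
  -- With no second state in `F`, the return time may be infinite; the absorbing alternative then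
  -- holds because the trace stays in `F`.
  · by_cases hex : ∃ ξ ∈ F, ξ ≠ η
    · obtain ⟨ξ, hξ, hξη⟩ := hex
      refine Or.inr ((R.lintegral_returnTime_trace_le hrec h hξη (hw hη) (hw hξ)).trans_lt ?_)
      exact ENNReal.add_lt_top.2
        ⟨(R.tabooPotential_traceMean_ne_top hirr hrec μ hμ h hsum ξ η).lt_top,
          (R.tabooPotential_traceMean_ne_top hirr hrec μ hμ h hsum η ξ).lt_top⟩
    · refine Or.inl ?_
      push Not at hex
      filter_upwards [R.ae_trace_mem hrec h (hw hη)] with ω hω t ht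
      exact hex _ (hmem.2 (hω t ht))
  · have hsymm := R.jumpMatrix_symm_of_transition R.holdMean (R.jumpMeasure μ) R.holdMean_ne_zero
      hσ0 (R.transition_holdMean_invariant hrec μ hμ) fun t ht η ξ => by
        rw [R.jumpMeasure_mul_holdMean, R.jumpMeasure_mul_holdMean, ← R.law_process_eq hrec _ _ ht,
          ← R.law_process_eq hrec _ _ ht]
        exact hrev.2 t ht ⟨η, mem_univ η⟩ ⟨ξ, mem_univ ξ⟩
    have h1 := R.transition_symm (R.traceMean h) hrec (R.jumpMeasure μ) hsymm (hw η.2) (hw ξ.2) ht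
    rw [R.jumpMeasure_mul_traceMean, R.jumpMeasure_mul_traceMean,
      ← R.law_trace_eq hrec h (hw η.2) _ ht, ← R.law_trace_eq hrec h (hw ξ.2) _ ht] at h1
    exact h1
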